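/- Let $r>0$, let $B=B(O,r)\subset\mathbb R^2$ be the open disc of radius $r$ centred at the origin $O$, with coordinates $(x,y)$, and let $g$ be a Riemannian metric on $B$ whose coefficients $g_{xx},g_{xy},g_{yy}$ are of class $C^4$ on $B$ and whose Gauss curvature $k$ satisfies $k>0$ on $B\setminus\{O\}$. Let $$X:(B,g)\to(\mathbb R^3,g_{can}),\qquad X(x,y)=(\alpha(x,y),\beta(x,y),u(x,y)),$$ be an isometric embedding of class $C^{1,1}$, where $\alpha,\beta\in C^5(B)$ and $$u(0,0)=0,\qquad u_x(0,0)=u_y(0,0)=0.$$ Then $X\in C^{2,1}(B)$. Here, for an open set $U$, $C^{m,1}(U)$ denotes the maps of class $C^m$ on $U$ whose $m$-th derivative is locally Lipschitz on $U$. -/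

import Mathlib

noncomputable section

/-- The parameter plane `ℝ²`, with coordinates `x = p 0` and `y = p 1`. -/
abbrev Plane : Type := EuclideanSpace ℝ (Fin 2)

/-- Euclidean three-space `(ℝ³, g_can)`. -/
abbrev Space : Type := EuclideanSpace ℝ (Fin 3)

/-- The partial derivative of `f` in the `i`-th coordinate direction at `p`. -/
def partialDeriv {F : Type*} [NormedAddCommGroup F] [NormedSpace ℝ F]
    (i : Fin 2) (f : Plane → F) (p : Plane) : F :=
  fderiv ℝ f p (EuclideanSpace.single i 1)

/-- `f ∈ C^{k,1}(U)` for an open set `U`: `f` is `C^k` on `U`, and its `k`-th derivative is locally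
Lipschitz on `U` (each point of `U` has a neighbourhood on which it is Lipschitz). -/
def IsCk1On {F : Type*} [NormedAddCommGroup F] [NormedSpace ℝ F]
    (k : ℕ) (f : Plane → F) (U : Set Plane) : Prop :=
  ContDiffOn ℝ k f U ∧ LocallyLipschitzOn U (iteratedFDeriv ℝ k f)

/-- `g`, given by its coefficient matrix `(g_ij)` in the coordinates `x, y`, is a Riemannian metric
of class `C^n` on `U`. -/
structure IsMetricOn (n : ℕ) (g : Plane → Matrix (Fin 2) (Fin 2) ℝ) (U : Set Plane) : Prop where
  contDiffOn : ∀ i j, ContDiffOn ℝ n (fun p => g p i j) U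
  posDef : ∀ p ∈ U, (g p).PosDef

/-- The Christoffel symbol `Γ^k_{ij}` of the Levi-Civita connection of `g`. -/
def christoffel (g : Plane → Matrix (Fin 2) (Fin 2) ℝ) (k i j : Fin 2) (p : Plane) : ℝ :=
  (1 / 2) * ∑ l, (g p)⁻¹ k l *
    (partialDeriv i (fun q => g q j l) p + partialDeriv j (fun q => g q i l) p
      - partialDeriv l (fun q => g q i j) p)

/-- The coefficient `R^l_{kij}` of the Riemann curvature tensor of `g`:
`R(∂_i, ∂_j) ∂_k = ∑ l, R^l_{kij} ∂_l`,
where `R(V, W) Z = ∇_V ∇_W Z - ∇_W ∇_V Z - ∇_{[V, W]} Z`. -/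
def riemann (g : Plane → Matrix (Fin 2) (Fin 2) ℝ) (l k i j : Fin 2) (p : Plane) : ℝ :=
  partialDeriv i (christoffel g l j k) p - partialDeriv j (christoffel g l i k) p
    + ∑ m, (christoffel g l i m p * christoffel g m j k p
      - christoffel g l j m p * christoffel g m i k p)

/-- The Gauss curvature of `g`: `⟨R(∂_x, ∂_y) ∂_y, ∂_x⟩ / (⟨∂_x, ∂_x⟩⟨∂_y, ∂_y⟩ - ⟨∂_x, ∂_y⟩²)`. -/
def gaussCurvature (g : Plane → Matrix (Fin 2) (Fin 2) ℝ) (p : Plane) : ℝ :=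
  (∑ l, g p 0 l * riemann g l 1 0 1 p) / (g p).det

/-- The `C^{1,1}` map `X : U → ℝ³` is an isometric embedding of `(U, g)`: it is a homeomorphism onto
its image, and it pulls the Euclidean metric of `ℝ³` back to `g`. (It is then an immersion, as `g` is
positive definite.) -/
structure IsC11IsometricEmbeddingOn (g : Plane → Matrix (Fin 2) (Fin 2) ℝ) (X : Plane → Space)
    (U : Set Plane) : Prop where
  isC11 : IsCk1On 1 X U
  isEmbedding : Topology.IsEmbedding (fun p : U => X p)
  isometric : ∀ p ∈ U, ∀ i j, inner ℝ (partialDeriv i X p) (partialDeriv j X p) = g p i j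

end

noncomputable section
open Set Filter Topology
open scoped NNReal

/-! The isometry condition reads `u_i u_j = g_ij - α_i α_j - β_i β_j`, so all products of first
derivatives of `u` are `C^4` (`contDiffOn_products`). Where `du ≠ 0` one may take a square root and
divide, and `u` is `C^5` (`contDiffAt_five_of_products`). Only critical points `q` of `u` remain. At
such a point `det g` is the square of the Jacobian of `(α, β)`, so `α, β` are local coordinates and
the surface is the graph of a function `v`. Two facts pass to `v`: the squares of its directional
derivatives `v_e` are `C^4`, and the Theorema Egregium turns `k > 0` into `det D²v > 0` at the
points other than `q` where `v` is `C^5` (`IsDarbouxSolution`).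

Since `dv` is Lipschitz, a positive Hessian determinant keeps `v_ee` away from zero. A second
critical point of `v` would therefore produce a whole segment of critical points, then an open set
of them, on which `D²v = 0`. So the critical point is isolated (`IsDarbouxSolution.fderiv_ne_zero`).

The heart is an estimate in one variable, `abs_second_deriv_le_of_sq`. On a line that misses `q`,
the function `f = v_e` has `f' = v_ee ≠ 0`, and the fourth derivative of `f²` is bounded. The cubic
Taylor polynomial of `f²` is then accurate up to a quartic error, and a large `f''` would contradict
either `f² ≥ 0` or the monotonicity of `f`. The resulting bound for `f'' = v_eee` does not depend on
the distance of the line from `q`. Four directions and polarization bound `D³v`, hence the third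
derivative of `X`, on a punctured neighbourhood. A `C^1` map with bounded third derivative off a
point is `C^{2,1}` across that point (`contDiffOn_two_of_bounded_third_deriv`). -/

/-! ### A one-variable estimate: `f''` from the fourth derivative of `f²` -/

theorem abs_le_pow_succ_of_abs_deriv_le_pow {G G' : ℝ → ℝ} {δ C a : ℝ} {n : ℕ} (hC : 0 ≤ C)
    (hG : ∀ s ∈ Icc (-δ) δ, HasDerivAt G (G' s) s) (ha : a ∈ Icc (-δ) δ) (hGa : G a = 0)
    (hb : ∀ x ∈ Icc (-δ) δ, |G' x| ≤ C * |x - a| ^ n) {s : ℝ} (hs : s ∈ Icc (-δ) δ) :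
    |G s| ≤ C * |s - a| ^ (n + 1) := by
  have hsub : uIcc a s ⊆ Icc (-δ) δ := uIcc_subset_Icc ha hs
  have h := (convex_uIcc a s).norm_image_sub_le_of_norm_hasDerivWithin_le
    (f := G) (f' := G') (C := C * |s - a| ^ n)
    (fun x hx => (hG x (hsub hx)).hasDerivWithinAt)
    (fun x hx => (hb x (hsub hx)).trans (by
      gcongr C * ?_ ^ n
      exact abs_sub_left_of_mem_uIcc hx)) left_mem_uIcc right_mem_uIcc
  rw [hGa, sub_zero, Real.norm_eq_abs, Real.norm_eq_abs] at h
  calc |G s| ≤ _ := h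
    _ = _ := by ring

/-- Four applications of the mean value inequality, starting from `F4`. The factorials in the
remainders are dropped, since only the order in `s - a` matters later. -/
theorem taylor_four_bounds {F0 F1 F2 F3 F4 : ℝ → ℝ} {δ M : ℝ}
    (h0 : ∀ s ∈ Icc (-δ) δ, HasDerivAt F0 (F1 s) s)
    (h1 : ∀ s ∈ Icc (-δ) δ, HasDerivAt F1 (F2 s) s)
    (h2 : ∀ s ∈ Icc (-δ) δ, HasDerivAt F2 (F3 s) s)
    (h3 : ∀ s ∈ Icc (-δ) δ, HasDerivAt F3 (F4 s) s)
    (hM : ∀ s ∈ Icc (-δ) δ, |F4 s| ≤ M) {a : ℝ} (ha : a ∈ Icc (-δ) δ) :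
    ∀ s ∈ Icc (-δ) δ,
      |F0 s - (F0 a + F1 a * (s - a) + F2 a / 2 * (s - a) ^ 2 + F3 a / 6 * (s - a) ^ 3)|
          ≤ M * |s - a| ^ 4 ∧
      |F1 s - (F1 a + F2 a * (s - a) + F3 a / 2 * (s - a) ^ 2)| ≤ M * |s - a| ^ 3 ∧
      |F2 s - (F2 a + F3 a * (s - a))| ≤ M * |s - a| ^ 2 := by
  have hM0 : 0 ≤ M := (abs_nonneg _).trans (hM a ha)
  have e3 : ∀ s ∈ Icc (-δ) δ, |F3 s - F3 a| ≤ M * |s - a| ^ (0 + 1) := fun s hs =>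
    abs_le_pow_succ_of_abs_deriv_le_pow (G := fun s => F3 s - F3 a) hM0
      (fun s hs => (h3 s hs).sub_const _) ha (by simp) (fun x hx => by simpa using hM x hx) hs
  have e2 : ∀ s ∈ Icc (-δ) δ, |F2 s - (F2 a + F3 a * (s - a))| ≤ M * |s - a| ^ (1 + 1) :=
    fun s hs =>
    abs_le_pow_succ_of_abs_deriv_le_pow (G := fun s => F2 s - (F2 a + F3 a * (s - a))) hM0
      (G' := fun s => F3 s - F3 a)
      (fun s hs => by
        refine ((h2 s hs).sub ((((hasDerivAt_id s).sub_const a).const_mul (F3 a)).const_add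
          (F2 a))).congr_deriv (by simp)) ha (by simp) e3 hs
  have e1 : ∀ s ∈ Icc (-δ) δ,
      |F1 s - (F1 a + F2 a * (s - a) + F3 a / 2 * (s - a) ^ 2)| ≤ M * |s - a| ^ (2 + 1) :=
    fun s hs =>
    abs_le_pow_succ_of_abs_deriv_le_pow
      (G := fun s => F1 s - (F1 a + F2 a * (s - a) + F3 a / 2 * (s - a) ^ 2)) hM0
      (G' := fun s => F2 s - (F2 a + F3 a * (s - a)))
      (fun s hs => by
        have i := (hasDerivAt_id s).sub_const a
        refine ((h1 s hs).sub (((i.const_mul (F2 a)).const_add (F1 a)).add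
          ((i.pow 2).const_mul (F3 a / 2)))).congr_deriv (by simp; ring)) ha (by simp) e2 hs
  have e0 : ∀ s ∈ Icc (-δ) δ,
      |F0 s - (F0 a + F1 a * (s - a) + F2 a / 2 * (s - a) ^ 2 + F3 a / 6 * (s - a) ^ 3)|
        ≤ M * |s - a| ^ (3 + 1) :=
    fun s hs =>
    abs_le_pow_succ_of_abs_deriv_le_pow
      (G := fun s => F0 s -
        (F0 a + F1 a * (s - a) + F2 a / 2 * (s - a) ^ 2 + F3 a / 6 * (s - a) ^ 3)) hM0
      (G' := fun s => F1 s - (F1 a + F2 a * (s - a) + F3 a / 2 * (s - a) ^ 2))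
      (fun s hs => by
        have i := (hasDerivAt_id s).sub_const a
        refine ((h0 s hs).sub ((((i.const_mul (F1 a)).const_add (F0 a)).add
          ((i.pow 2).const_mul (F2 a / 2))).add
          ((i.pow 3).const_mul (F3 a / 6)))).congr_deriv (by simp; ring)) ha (by simp) e1 hs
  exact fun s hs => ⟨e0 s hs, e1 s hs, e2 s hs⟩

/-- A nonnegative quartic whose lower order part is that of the square of `f0 + g0 s + h s² / 2`
bounds `h` from below. -/
theorem neg_le_of_quartic_nonneg {δ N f0 g0 h c : ℝ} (hδ : 0 < δ) (hN : 0 < N) (hf : 0 < f0)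
    (hg : 0 < g0) (hgN : g0 ≤ N * δ) (hfN : f0 ≤ N * δ ^ 2)
    (H : ∀ s ∈ Icc (-δ) δ,
      0 ≤ f0 ^ 2 + 2 * f0 * g0 * s + (g0 ^ 2 + f0 * h) * s ^ 2 + c * s ^ 3 + N ^ 2 * s ^ 4) :
    -(8 * N) ≤ h := by
  by_contra! hh
  obtain ⟨κ, rfl⟩ : ∃ κ, h = -(2 * κ) := ⟨-h / 2, by ring⟩
  have hκ : 4 * N < κ := by linarith
  have hκ0 : 0 < κ := by linarith
  set D := g0 ^ 2 + 4 * κ * f0 with hD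
  have hDpos : 0 < D := by positivity
  set S := √D
  have hSS : S ^ 2 = D := Real.sq_sqrt hDpos.le
  have hS0 : 0 ≤ S := Real.sqrt_nonneg _
  have hSg : g0 < S := by
    apply Real.lt_sqrt_of_sq_lt
    have : 0 < κ * f0 := by positivity
    linarith
  have hκδ : N * δ ≤ κ * δ / 4 := by nlinarith
  have hSu : S ≤ 3 / 2 * (κ * δ) := by
    apply Real.sqrt_le_iff.2 ⟨by positivity, ?_⟩
    have h1 : g0 ^ 2 ≤ (κ * δ / 4) ^ 2 := by
      apply pow_le_pow_left₀ hg.le; linarith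
    have h2 : κ * f0 ≤ κ * (κ * δ ^ 2 / 4) := by
      gcongr
      nlinarith [sq_nonneg δ]
    rw [hD]
    nlinarith [sq_nonneg (κ * δ)]
  -- With `Q = f0 + g0 s - κ s²`, the quartic is `Q² + s² ((c + 2 g0 κ) s - (κ² - N²) s²)`. At a
  -- root of `Q` its nonnegativity fixes the sign of `(c + 2 g0 κ) s`, which is impossible for two
  -- roots of opposite sign.
  have key : ∀ s, s ≠ 0 → s ∈ Icc (-δ) δ → f0 + g0 * s - κ * s ^ 2 = 0 →
      0 < (c + 2 * g0 * κ) * s := by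
    intro s hs0 hs hQ
    have h1 := H s hs
    have h2 : f0 ^ 2 + 2 * f0 * g0 * s + (g0 ^ 2 + f0 * -(2 * κ)) * s ^ 2 + c * s ^ 3 + N ^ 2 * s ^ 4
        = (f0 + g0 * s - κ * s ^ 2) ^ 2 + s ^ 2 * ((c + 2 * g0 * κ) * s - (κ ^ 2 - N ^ 2) * s ^ 2) := by
      ring
    rw [h2, hQ] at h1
    have hs2 : 0 < s ^ 2 := by positivity
    have h3 : 0 ≤ (c + 2 * g0 * κ) * s - (κ ^ 2 - N ^ 2) * s ^ 2 := by
      by_contra! hc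
      nlinarith [mul_neg_of_pos_of_neg hs2 hc]
    have h4 : 0 < (κ ^ 2 - N ^ 2) * s ^ 2 := by
      apply mul_pos _ hs2
      nlinarith
    linarith
  -- The roots have opposite signs because `g0 < S`. Their modulus is at most `(g0 + S) / (2κ) ≤
  -- (1/4 + 3/2) δ / 2 < δ`, so both are admissible.
  have hp : 0 < (g0 + S) / (2 * κ) := by positivity
  have hm : (g0 - S) / (2 * κ) < 0 := div_neg_of_neg_of_pos (by linarith) (by positivity)
  have k1 := key ((g0 + S) / (2 * κ)) hp.ne'
    ⟨by linarith, by rw [div_le_iff₀ (by positivity)]; linarith [mul_pos hκ0 hδ]⟩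
    (by field_simp; linarith [hSS, hD])
  have k2 := key ((g0 - S) / (2 * κ)) hm.ne
    ⟨by rw [le_div_iff₀ (by positivity)]; linarith [mul_pos hκ0 hδ], by linarith⟩
    (by field_simp; linarith [hSS, hD])
  have := pos_of_mul_pos_left k1 hp.le
  linarith [mul_neg_of_pos_of_neg this hm]

/-- The length `l` is chosen so that the quartic error `N² l⁴` equals `f0²`. The cubic is then
bounded by a multiple of `f0²` on an interval of length `l`, and so are its rescaled coefficients.
The term `g0²` in the quadratic coefficient has the favourable sign and is discarded. -/
theorem le_of_sq_cubic_interpolation {f0 g0 h c N l : ℝ} (hf : 0 < f0) (hl : 0 < l)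
    (hlN : l ^ 2 * N = f0) {F : ℝ → ℝ} (hF0 : ∀ s ∈ Icc (-l) 0, 0 ≤ F s)
    (hF1 : ∀ s ∈ Icc (-l) 0, F s ≤ f0 ^ 2)
    (hT : ∀ s ∈ Icc (-l) 0,
      |F s - (f0 ^ 2 + 2 * f0 * g0 * s + (g0 ^ 2 + f0 * h) * s ^ 2 + c * s ^ 3)| ≤
        N ^ 2 * |s| ^ 4) :
    h ≤ 500 * N := by
  have hE : N ^ 2 * l ^ 4 = f0 ^ 2 := by rw [← hlN]; ring
  have key : ∀ σ ∈ Icc (0 : ℝ) 1,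
      -(2 * f0 ^ 2) ≤ -(2 * f0 * g0 * l) * σ + ((g0 ^ 2 + f0 * h) * l ^ 2) * σ ^ 2
        - (c * l ^ 3) * σ ^ 3 ∧
      -(2 * f0 * g0 * l) * σ + ((g0 ^ 2 + f0 * h) * l ^ 2) * σ ^ 2 - (c * l ^ 3) * σ ^ 3
        ≤ 2 * f0 ^ 2 := by
    intro σ hσ
    have hs : -(l * σ) ∈ Icc (-l) 0 := ⟨by nlinarith [hσ.2], by nlinarith [hσ.1]⟩
    have h1 := abs_le.1 (hT _ hs)
    have h2 := hF0 _ hs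
    have h3 := hF1 _ hs
    have h4 : N ^ 2 * |-(l * σ)| ^ 4 ≤ f0 ^ 2 := by
      rw [abs_neg, abs_of_nonneg (mul_nonneg hl.le hσ.1), mul_pow, ← mul_assoc, hE]
      exact mul_le_of_le_one_right (sq_nonneg _) (pow_le_one₀ hσ.1 hσ.2)
    have hf2 := sq_nonneg f0
    constructor <;> nlinarith
  -- A cubic `p` with `p(0) = 0` has quadratic coefficient `-(45/2) p(1/3) + 18 p(2/3) - (9/2)
  -- p(1)`. Values bounded by `2 f0²` thus give at most `90 f0²`; the constant 500 is generous.
  have k1 := key (1 / 3) (by norm_num)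
  have k2 := key (2 / 3) (by norm_num)
  have k3 := key 1 (by norm_num)
  have h5 : (g0 ^ 2 + f0 * h) * l ^ 2 ≤ 500 * f0 ^ 2 := by
    set A := 2 * f0 * g0 * l
    set B := (g0 ^ 2 + f0 * h) * l ^ 2
    set D := c * l ^ 3
    have := sq_nonneg f0
    linarith [k1.1, k1.2, k2.1, k2.2, k3.1, k3.2]
  have h6 : f0 * l ^ 2 * h ≤ f0 * l ^ 2 * (500 * N) := by
    have : f0 * l ^ 2 * (500 * N) = 500 * f0 ^ 2 := by
      rw [show f0 * l ^ 2 * (500 * N) = 500 * f0 * (l ^ 2 * N) by ring, hlN]; ring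
    have h7 : 0 ≤ g0 ^ 2 * l ^ 2 := by positivity
    nlinarith
  exact le_of_mul_le_mul_left h6 (by positivity)

/-- This serves the case where `f` vanishes at distance `t` to the left of `0`. The square `F = f²`
has a double zero there, so `F ≈ a τ² + b τ³`, and `e0`, `e1`, `e2` read off `F`, `F'`, `F''` at `τ
= t`. Nonnegativity of `F` on the far side of the zero, at `τ = t - ρ`, bounds `b` from above.
Eliminating `a` from the three expansions then bounds `h`. -/
theorem le_of_double_zero_expansion {f0 g0 h a b t N F2 r0 r1 r2 : ℝ} (hf : 0 < f0) (hN : 0 < N)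
    (ht : 0 < t) (htN : N * t ^ 2 ≤ f0)
    (e0 : f0 ^ 2 = a * t ^ 2 + b * t ^ 3 + r0) (e1 : 2 * f0 * g0 = 2 * a * t + 3 * b * t ^ 2 + r1)
    (e2 : F2 = 2 * a + 6 * b * t + r2) (eh : F2 = 2 * g0 ^ 2 + 2 * f0 * h)
    (hr0 : |r0| ≤ N ^ 2 * t ^ 4) (hr1 : |r1| ≤ N ^ 2 * t ^ 3) (hr2 : |r2| ≤ N ^ 2 * t ^ 2)
    (hpos : 0 ≤ a + b * (t - f0 / (t * N)) + N ^ 2 * (t - f0 / (t * N)) ^ 2) :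
    h ≤ 6 * N := by
  obtain ⟨ρ, hρ⟩ : ∃ ρ, ρ = f0 / (t * N) := ⟨_, rfl⟩
  rw [← hρ] at hpos
  have hρ0 : 0 < ρ := by rw [hρ]; positivity
  have hfρ : f0 = ρ * t * N := by rw [hρ]; field_simp
  have htρ : t ≤ ρ := by
    rw [hρ, le_div_iff₀ (by positivity)]; linarith
  have hr0' := abs_le.1 hr0
  have hr1' := abs_le.1 hr1
  have hr2' := abs_le.1 hr2
  have hab : a + b * t ≤ N ^ 2 * ρ ^ 2 + N ^ 2 * t ^ 2 := by
    have : (a + b * t) * t ^ 2 ≤ (N ^ 2 * ρ ^ 2 + N ^ 2 * t ^ 2) * t ^ 2 := by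
      have : (a + b * t) * t ^ 2 = f0 ^ 2 - r0 := by rw [e0]; ring
      rw [this, hfρ]; nlinarith
    exact le_of_mul_le_mul_right this (by positivity)
  have hb : b ≤ 3 * N ^ 2 * ρ := by
    have h1 : (t - ρ) ^ 2 ≤ ρ ^ 2 := by nlinarith
    have h2 : t ^ 2 ≤ ρ ^ 2 := by nlinarith
    have h3 : b * ρ ≤ 3 * N ^ 2 * ρ * ρ := by
      have hN2 : 0 ≤ N ^ 2 := sq_nonneg N
      nlinarith [mul_le_mul_of_nonneg_left h1 hN2, mul_le_mul_of_nonneg_left h2 hN2]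
    exact le_of_mul_le_mul_right h3 hρ0
  obtain ⟨y, hy⟩ : ∃ y, y = b * t ^ 3 + r1 * t - 2 * r0 := ⟨_, rfl⟩
  have hgy : (2 * f0 * g0) * t = 2 * f0 ^ 2 + y := by rw [e1, e0, hy]; ring
  -- Squaring `2 f0 g0 t = 2 f0² + y` and dropping `y²` bounds `g0² t²` below. The terms `f0²` then
  -- cancel in `2 f0 h t² = F'' t² - 2 g0² t²`.
  have hg2 : f0 ^ 2 + y ≤ g0 ^ 2 * t ^ 2 := by
    have h1 : f0 ^ 2 * (4 * (g0 ^ 2 * t ^ 2)) = (2 * f0 ^ 2 + y) ^ 2 := by rw [← hgy]; ring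
    have h2 : f0 ^ 2 * (4 * (f0 ^ 2 + y)) ≤ f0 ^ 2 * (4 * (g0 ^ 2 * t ^ 2)) := by
      rw [h1]; nlinarith [sq_nonneg y]
    have := le_of_mul_le_mul_left h2 (by positivity)
    linarith
  have hF2 : F2 * t ^ 2 = 2 * f0 ^ 2 + 4 * b * t ^ 3 + r2 * t ^ 2 - 2 * r0 := by
    rw [e2, e0]; ring
  have hfin : 2 * f0 * h * t ^ 2 ≤ 2 * b * t ^ 3 + r2 * t ^ 2 - 2 * r1 * t + 2 * r0 := by
    have : 2 * f0 * h * t ^ 2 = F2 * t ^ 2 - 2 * (g0 ^ 2 * t ^ 2) := by rw [eh]; ring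
    rw [this, hF2]
    rw [hy] at hg2
    linarith
  have hbt : b * t ^ 3 ≤ 3 * N ^ 2 * ρ * t ^ 3 := by gcongr
  have hr2t : r2 * t ^ 2 ≤ N ^ 2 * t ^ 4 := by
    have := mul_le_mul_of_nonneg_right hr2'.2 (sq_nonneg t)
    linarith
  have hr1t : -(r1 * t) ≤ N ^ 2 * t ^ 4 := by
    have := mul_le_mul_of_nonneg_right hr1'.1 ht.le
    linarith
  have h4 : N ^ 2 * t ^ 4 ≤ N ^ 2 * ρ * t ^ 3 := by
    have : N ^ 2 * t ^ 3 * t ≤ N ^ 2 * t ^ 3 * ρ := by gcongr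
    linarith
  have h5 : (2 * f0 * t ^ 2) * h ≤ (2 * f0 * t ^ 2) * (6 * N) := by
    have : (2 * f0 * t ^ 2) * (6 * N) = 12 * (N ^ 2 * ρ * t ^ 3) := by rw [hfρ]; ring
    rw [this]; linarith [hr0'.2]
  exact le_of_mul_le_mul_left h5 (by positivity)

/-- The lower bound comes from `f² ≥ 0` alone. The upper bound distinguishes whether `f` vanishes
within the natural length `√(f(0)/N)` to the left of `0`. The bounds `N δ` and `N δ²` on `f'` and
`f(0)` ensure that every test point lies in `[-δ, δ]`. -/
theorem abs_second_deriv_le_of_pos {f f1 f2 f3 f4 : ℝ → ℝ} {δ N : ℝ} (hδ : 0 < δ) (hN : 0 < N)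
    (d0 : ∀ s ∈ Icc (-δ) δ, HasDerivAt f (f1 s) s) (d1 : ∀ s ∈ Icc (-δ) δ, HasDerivAt f1 (f2 s) s)
    (d2 : ∀ s ∈ Icc (-δ) δ, HasDerivAt f2 (f3 s) s) (d3 : ∀ s ∈ Icc (-δ) δ, HasDerivAt f3 (f4 s) s)
    (hpos : ∀ s ∈ Icc (-δ) δ, 0 < f1 s) (hL : ∀ s ∈ Icc (-δ) δ, f1 s ≤ N * δ)
    (hf : f 0 ≤ N * δ ^ 2) (hf0 : 0 ≤ f 0)
    (hM : ∀ s ∈ Icc (-δ) δ, |6 * f2 s ^ 2 + 8 * f1 s * f3 s + 2 * f s * f4 s| ≤ N ^ 2) :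
    |f2 0| ≤ 500 * N := by
  have m0 : (0 : ℝ) ∈ Icc (-δ) δ := ⟨by linarith, hδ.le⟩
  have T := fun {a : ℝ} (ha : a ∈ Icc (-δ) δ) => taylor_four_bounds
    (F0 := fun s => f s ^ 2) (F1 := fun s => 2 * f s * f1 s)
    (F2 := fun s => 2 * f1 s ^ 2 + 2 * f s * f2 s)
    (F3 := fun s => 6 * f1 s * f2 s + 2 * f s * f3 s)
    (fun s hs => ((d0 s hs).pow 2).congr_deriv (by simp))
    (fun s hs => (((d0 s hs).const_mul 2).mul (d1 s hs)).congr_deriv (by ring))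
    (fun s hs => ((((d1 s hs).pow 2).const_mul 2).add (((d0 s hs).const_mul 2).mul
      (d2 s hs))).congr_deriv (by simp; ring))
    (fun s hs => ((((d1 s hs).const_mul 6).mul (d2 s hs)).add (((d0 s hs).const_mul 2).mul
      (d3 s hs))).congr_deriv (by ring))
    hM ha
  have T0 : ∀ s ∈ Icc (-δ) δ, |f s ^ 2 - (f 0 ^ 2 + 2 * f 0 * f1 0 * s +
      (f1 0 ^ 2 + f 0 * f2 0) * s ^ 2 + (f1 0 * f2 0 + f 0 * f3 0 / 3) * s ^ 3)|
        ≤ N ^ 2 * |s| ^ 4 := by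
    intro s hs
    have := (T m0 s hs).1
    simp only [sub_zero] at this
    convert this using 3
    ring
  have Q : ∀ s ∈ Icc (-δ) δ, 0 ≤ f 0 ^ 2 + 2 * f 0 * f1 0 * s +
      (f1 0 ^ 2 + f 0 * f2 0) * s ^ 2 + (f1 0 * f2 0 + f 0 * f3 0 / 3) * s ^ 3 + N ^ 2 * s ^ 4 := by
    intro s hs
    have h1 := (abs_le.1 (T0 s hs)).2
    have h2 : |s| ^ 4 = s ^ 4 := by rw [← abs_pow, abs_of_nonneg (by positivity)]
    rw [h2] at h1
    linarith [sq_nonneg (f s)]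
  have hg := hpos 0 m0
  have hgN := hL 0 m0
  rcases hf0.eq_or_lt with h0 | h0
  · by_contra! hc
    have hh0 : f2 0 ≠ 0 := by
      intro h; rw [h, abs_zero] at hc; linarith
    -- When `f(0) = 0`, the comparison quartic is `s² (f'² + f' f'' s + N² s²)`, and this test point
    -- makes it negative as soon as `|f''| > 2N`.
    have hs : -2 * f1 0 / f2 0 ∈ Icc (-δ) δ := by
      rw [mem_Icc, ← abs_le, abs_div, div_le_iff₀ (by positivity), abs_mul, abs_of_pos hg]
      norm_num
      nlinarith
    have h1 := Q _ hs
    rw [← h0] at h1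
    have h2 : (0 : ℝ) ^ 2 + 2 * 0 * f1 0 * (-2 * f1 0 / f2 0) +
      (f1 0 ^ 2 + 0 * f2 0) * (-2 * f1 0 / f2 0) ^ 2 +
      (f1 0 * f2 0 + 0 * f3 0 / 3) * (-2 * f1 0 / f2 0) ^ 3 + N ^ 2 * (-2 * f1 0 / f2 0) ^ 4
      = 4 * f1 0 ^ 4 / f2 0 ^ 4 * (4 * N ^ 2 - f2 0 ^ 2) := by
      field_simp; ring
    rw [h2] at h1
    have h3 : 0 < 4 * f1 0 ^ 4 / f2 0 ^ 4 := by positivity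
    have h4 : 4 * N ^ 2 < f2 0 ^ 2 := by
      rw [← sq_abs (f2 0)]; nlinarith
    nlinarith [mul_neg_of_pos_of_neg h3 (sub_neg.2 h4)]
  have hlow := neg_le_of_quartic_nonneg hδ hN h0 hg hgN hf Q
  have hmono : StrictMonoOn f (Icc (-δ) δ) := by
    apply strictMonoOn_of_deriv_pos (convex_Icc _ _)
      (fun s hs => (d0 s hs).continuousAt.continuousWithinAt)
    intro s hs
    rw [interior_Icc] at hs
    rw [(d0 s (Ioo_subset_Icc_self hs)).deriv]
    exact hpos s (Ioo_subset_Icc_self hs)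
  suffices f2 0 ≤ 500 * N from abs_le.2 ⟨by linarith, this⟩
  set l := √(f 0 / N) with hl
  have hl0 : 0 < l := by positivity
  have hlN : l ^ 2 * N = f 0 := by
    rw [hl, Real.sq_sqrt (by positivity)]; field_simp
  have hlδ : l ≤ δ := by
    apply Real.sqrt_le_iff.2 ⟨hδ.le, ?_⟩
    rw [div_le_iff₀ hN]; linarith
  have hsub : Icc (-l) 0 ⊆ Icc (-δ) δ := Icc_subset_Icc (by linarith) hδ.le
  have ml : -l ∈ Icc (-δ) δ := hsub ⟨le_rfl, by linarith⟩
  rcases le_or_gt (f (-l)) 0 with hz | hz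
  · obtain ⟨z, hzm, hfz⟩ : (0 : ℝ) ∈ f '' Icc (-l) 0 :=
      intermediate_value_Icc (by linarith)
        (fun s hs => (d0 s (hsub hs)).continuousAt.continuousWithinAt) ⟨hz, h0.le⟩
    have hzδ := hsub hzm
    have hz0 : z < 0 := lt_of_le_of_ne hzm.2 (by rintro rfl; linarith)
    have T1 := T hzδ 0 m0
    have hbd : f 0 ≤ N * δ * (-z) := by
      have := (convex_Icc (-δ) δ).image_sub_le_mul_sub_of_deriv_le (f := f) (C := N * δ)
        (fun s hs => (d0 s hs).continuousAt.continuousWithinAt)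
        (fun s hs => (d0 s (interior_subset hs)).differentiableAt.differentiableWithinAt)
        (fun s hs => by
          rw [(d0 s (interior_subset hs)).deriv]; exact hL s (interior_subset hs))
        z hzδ 0 m0 hz0.le
      linarith
    have ht : 0 < -z := by linarith
    have hztl : (-z) ^ 2 ≤ l ^ 2 := by
      apply pow_le_pow_left₀ ht.le; linarith [hzm.1]
    -- The second test point `-ρ` is the scale required by `le_of_double_zero_expansion`. The mean
    -- value inequality `f(0) ≤ N δ (-z)` is what gives `ρ ≤ δ`.
    set ρ := f 0 / (-z * N) with hρ
    have hρ0 : 0 < ρ := by positivity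
    have hρδ : ρ ≤ δ := by
      rw [hρ, div_le_iff₀ (by positivity)]; linarith
    have hmρ : -ρ ∈ Icc (-δ) δ := ⟨by linarith, by linarith⟩
    have h2 := (T hzδ (-ρ) hmρ).1
    simp only [hfz] at T1 h2
    have hab : |(0 : ℝ) - z| = -z := by rw [zero_sub, abs_of_pos ht]
    rw [hab] at T1
    refine le_of_double_zero_expansion (f0 := f 0) (g0 := f1 0) (a := f1 z ^ 2)
      (b := f1 z * f2 z) (t := -z) (N := N) (F2 := 2 * f1 0 ^ 2 + 2 * f 0 * f2 0)
      (r0 := f 0 ^ 2 - (f1 z ^ 2 * (-z) ^ 2 + f1 z * f2 z * (-z) ^ 3))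
      (r1 := 2 * f 0 * f1 0 - (2 * f1 z ^ 2 * (-z) + 3 * (f1 z * f2 z) * (-z) ^ 2))
      (r2 := 2 * f1 0 ^ 2 + 2 * f 0 * f2 0 - (2 * f1 z ^ 2 + 6 * (f1 z * f2 z) * (-z)))
      h0 hN ht (by rw [← hlN]; nlinarith) (by ring) (by ring) (by ring) rfl ?_ ?_ ?_ ?_ |>.trans
        (by linarith)
    · convert T1.1 using 2; ring
    · convert T1.2.1 using 2; ring
    · convert T1.2.2 using 2; ring
    · rw [← hρ]
      -- The Taylor bound at `-ρ` carries a factor `(-z - ρ)²` to be divided out. If it vanishes,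
      -- the claim reduces to `f'(z)² ≥ 0`.
      rcases eq_or_ne (-z - ρ) 0 with hτ | hτ
      · rw [hτ]; nlinarith [sq_nonneg (f1 z)]
      have h3 := (abs_le.1 h2).2
      rw [← abs_pow, abs_of_nonneg (by positivity : (0 : ℝ) ≤ (-ρ - z) ^ 4)] at h3
      have h4 : 0 < (-z - ρ) ^ 2 := by positivity
      have h5 : 0 ≤ (-z - ρ) ^ 2 * (f1 z ^ 2 + f1 z * f2 z * (-z - ρ) + N ^ 2 * (-z - ρ) ^ 2) := by
        linarith [sq_nonneg (f (-ρ))]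
      exact nonneg_of_mul_nonneg_right h5 h4
  · have hfnn : ∀ s ∈ Icc (-l) 0, 0 ≤ f s := fun s hs =>
      hz.le.trans (hmono.monotoneOn ml (hsub hs) hs.1)
    exact le_of_sq_cubic_interpolation h0 hl0 hlN (F := fun s => f s ^ 2)
      (fun s hs => sq_nonneg _)
      (fun s hs => pow_le_pow_left₀ (hfnn s hs) (hmono.monotoneOn (hsub hs) m0 hs.2) 2)
      (fun s hs => T0 s (hsub hs))

/-- If `f` has no critical points, its second derivative is controlled by the fourth derivative
of `f ^ 2`. -/
theorem abs_second_deriv_le_of_sq {f f1 f2 f3 f4 : ℝ → ℝ} {δ N : ℝ} (hδ : 0 < δ) (hN : 0 < N)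
    (d0 : ∀ s ∈ Icc (-δ) δ, HasDerivAt f (f1 s) s) (d1 : ∀ s ∈ Icc (-δ) δ, HasDerivAt f1 (f2 s) s)
    (d2 : ∀ s ∈ Icc (-δ) δ, HasDerivAt f2 (f3 s) s) (d3 : ∀ s ∈ Icc (-δ) δ, HasDerivAt f3 (f4 s) s)
    (hne : ∀ s ∈ Icc (-δ) δ, f1 s ≠ 0) (hL : ∀ s ∈ Icc (-δ) δ, |f1 s| ≤ N * δ)
    (hf : |f 0| ≤ N * δ ^ 2)
    (hM : ∀ s ∈ Icc (-δ) δ, |6 * f2 s ^ 2 + 8 * f1 s * f3 s + 2 * f s * f4 s| ≤ N ^ 2) :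
    |f2 0| ≤ 500 * N := by
  -- A continuous nonvanishing derivative has constant sign, and `f ↦ -f` leaves `f²` unchanged.
  wlog hpos : ∀ s ∈ Icc (-δ) δ, 0 < f1 s generalizing f f1 f2 f3 f4
  · have hneg : ∀ s ∈ Icc (-δ) δ, f1 s < 0 := by
      push Not at hpos
      obtain ⟨a, ha, ha0⟩ := hpos
      intro s hs
      by_contra! hc
      have hsub : uIcc a s ⊆ Icc (-δ) δ := uIcc_subset_Icc ha hs
      obtain ⟨c, hc, hc0⟩ := intermediate_value_uIcc (f := f1) (a := a) (b := s)
        (fun x hx => (d1 x (hsub hx)).continuousAt.continuousWithinAt)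
        (mem_uIcc.2 (Or.inl ⟨ha0, hc⟩))
      exact hne c (hsub hc) hc0
    have := this (f := fun s => -f s) (f1 := fun s => -f1 s) (f2 := fun s => -f2 s)
      (f3 := fun s => -f3 s) (f4 := fun s => -f4 s) (fun s hs => (d0 s hs).neg)
      (fun s hs => (d1 s hs).neg) (fun s hs => (d2 s hs).neg) (fun s hs => (d3 s hs).neg)
      (fun s hs => neg_ne_zero.2 (hne s hs)) (fun s hs => by simpa using hL s hs) (by simpa using hf)
      (fun s hs => by simpa using hM s hs) (fun s hs => neg_pos.2 (hneg s hs))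
    simpa using this
  -- The substitution `f(s) ↦ -f(-s)` changes the sign of `f(0)` and preserves `f' > 0`.
  wlog hf0 : 0 ≤ f 0 generalizing f f1 f2 f3 f4
  · have hm : ∀ s ∈ Icc (-δ) δ, -s ∈ Icc (-δ) δ := fun s hs => ⟨by linarith [hs.2], by linarith [hs.1]⟩
    have := this (f := fun s => -f (-s)) (f1 := fun s => f1 (-s)) (f2 := fun s => -f2 (-s))
      (f3 := fun s => f3 (-s)) (f4 := fun s => -f4 (-s))
      (fun s hs => ((d0 _ (hm s hs)).comp s (hasDerivAt_neg s)).neg.congr_deriv (by simp))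
      (fun s hs => ((d1 _ (hm s hs)).comp s (hasDerivAt_neg s)).congr_deriv (by simp))
      (fun s hs => ((d2 _ (hm s hs)).comp s (hasDerivAt_neg s)).neg.congr_deriv (by simp))
      (fun s hs => ((d3 _ (hm s hs)).comp s (hasDerivAt_neg s)).congr_deriv (by simp))
      (fun s hs => hne _ (hm s hs)) (fun s hs => hL _ (hm s hs)) (by simpa using hf)
      (fun s hs => by simpa using hM _ (hm s hs)) (fun s hs => hpos _ (hm s hs))
      (by simp; linarith)
    simpa using this
  exact abs_second_deriv_le_of_pos hδ hN d0 d1 d2 d3 hpos (fun s hs => (le_abs_self _).trans (hL s hs))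
    ((le_abs_self _).trans hf) hf0 hM

/-! ### Removable singularities in the plane -/

section Removable

set_option maxSynthPendingDepth 3

variable {F : Type*} [NormedAddCommGroup F] [NormedSpace ℝ F]

/-- Any `w` transverse to `b - a` works: the tilted line meets the original one only at `a`, which
is not `q`. -/
theorem exists_direction_notMem_segment {a b q : Plane} (hab : a ≠ b) (ha : a ≠ q)
    (hq : q ∈ segment ℝ a b) : ∃ w : Plane, ∀ t : ℝ, t ≠ 0 → q ∉ segment ℝ a (b + t • w) := by
  obtain ⟨w, hw⟩ := exists_linearIndependent_pair_of_one_lt_finrank (R := ℝ)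
    (M := Plane) (by simp) (sub_ne_zero.2 hab.symm)
  refine ⟨w, fun t ht hqt => ?_⟩
  rw [segment_eq_image'] at hq hqt
  obtain ⟨s, -, hs⟩ := hq
  obtain ⟨s', -, hs'⟩ := hqt
  have h : (s' - s) • (b - a) + (s' * t) • w = 0 := by
    have : a + s • (b - a) = a + s' • (b + t • w - a) := hs.trans hs'.symm
    have h2 := add_left_cancel this
    have e : (s' - s) • (b - a) + (s' * t) • w = s' • (b + t • w - a) - s • (b - a) := by module
    rw [e, h2, sub_self]
  obtain ⟨h1, h2⟩ := LinearIndependent.pair_iff.1 hw _ _ h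
  have hs'0 : s' = 0 := by simpa [ht] using h2
  have hs0 : s = 0 := by linarith
  apply ha
  simpa [hs0] using hs

/-- The punctured disc is not convex, but a segment through `q` is a limit of segments that miss it,
and `H` is continuous at the endpoint `b`. -/
theorem norm_image_sub_le_of_punctured {H : Plane → F} {q : Plane} {r K : ℝ}
    (hd : ∀ p ∈ Metric.ball q r, p ≠ q → DifferentiableAt ℝ H p)
    (hK : ∀ p ∈ Metric.ball q r, p ≠ q → ‖fderiv ℝ H p‖ ≤ K) {a b : Plane}
    (ha : a ∈ Metric.ball q r) (hb : b ∈ Metric.ball q r) (haq : a ≠ q) (hbq : b ≠ q) :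
    ‖H b - H a‖ ≤ K * ‖b - a‖ := by
  have main : ∀ b ∈ Metric.ball q r, q ∉ segment ℝ a b → ‖H b - H a‖ ≤ K * ‖b - a‖ := by
    intro b hb hq
    have hsub := (convex_ball q r).segment_subset ha hb
    have hne : ∀ x ∈ segment ℝ a b, x ≠ q := fun x hx h => hq (h ▸ hx)
    exact (convex_segment a b).norm_image_sub_le_of_norm_fderiv_le
      (fun x hx => hd x (hsub hx) (hne x hx)) (fun x hx => hK x (hsub hx) (hne x hx))
      (left_mem_segment ℝ a b) (right_mem_segment ℝ a b)
  by_cases hq : q ∈ segment ℝ a b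
  · rcases eq_or_ne a b with rfl | hab
    · simp
    obtain ⟨w, hw⟩ := exists_direction_notMem_segment hab haq hq
    have hc : ContinuousAt (fun t : ℝ => b + t • w) 0 := by fun_prop
    have hc0 : Tendsto (fun t : ℝ => b + t • w) (𝓝[≠] 0) (𝓝 b) := by
      have := hc.tendsto
      simp only [zero_smul, add_zero] at this
      exact this.mono_left nhdsWithin_le_nhds
    have h1 : Tendsto (fun t : ℝ => ‖H (b + t • w) - H a‖) (𝓝[≠] 0) (𝓝 ‖H b - H a‖) :=
      (((hd b hb hbq).continuousAt.tendsto.comp hc0).sub_const _).norm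
    have h2 : Tendsto (fun t : ℝ => K * ‖b + t • w - a‖) (𝓝[≠] 0) (𝓝 (K * ‖b - a‖)) :=
      ((hc0.sub_const _).norm).const_mul _
    refine le_of_tendsto_of_tendsto h1 h2 ?_
    filter_upwards [hc0.eventually (Metric.isOpen_ball.mem_nhds hb), self_mem_nhdsWithin]
      with t ht ht0
    exact main _ ht (hw t ht0)
  · exact main b hb hq

/-- The mean value inequality on a small punctured disc is applied to `f - L`, and one endpoint then
tends to `q`. -/
theorem hasFDerivAt_of_tendsto_fderiv_punctured {f : Plane → F} {q : Plane} {r : ℝ} (hr : 0 < r)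
    (hd : ∀ p ∈ Metric.ball q r, p ≠ q → DifferentiableAt ℝ f p) (hc : ContinuousAt f q)
    {L : Plane →L[ℝ] F} (hL : Tendsto (fderiv ℝ f) (𝓝[≠] q) (𝓝 L)) : HasFDerivAt f L q := by
  rw [hasFDerivAt_iff_isLittleO, Asymptotics.isLittleO_iff]
  intro ε hε
  obtain ⟨ρ, hρ, hρL⟩ : ∃ ρ > 0, ∀ p ∈ Metric.ball q ρ, p ≠ q → ‖fderiv ℝ f p - L‖ ≤ ε := by
    have := hL.eventually (Metric.closedBall_mem_nhds L hε)
    rw [eventually_nhdsWithin_iff, Metric.eventually_nhds_iff_ball] at this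
    obtain ⟨ρ, hρ, h⟩ := this
    exact ⟨ρ, hρ, fun p hp hpq => by simpa [dist_eq_norm] using h p hp hpq⟩
  have hm : 0 < min r ρ := lt_min hr hρ
  filter_upwards [Metric.ball_mem_nhds q hm] with x hx
  rcases eq_or_ne x q with rfl | hxq
  · simp
  have key : ∀ y ∈ Metric.ball q (min r ρ), y ≠ q →
      ‖(f x - L x) - (f y - L y)‖ ≤ ε * ‖x - y‖ := by
    intro y hy hyq
    have hdd : ∀ p ∈ Metric.ball q (min r ρ), p ≠ q → HasFDerivAt (fun z => f z - L z)
        (fderiv ℝ f p - L) p := fun p hp hpq =>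
      ((hd p (Metric.ball_subset_ball (min_le_left _ _) hp) hpq).hasFDerivAt).sub L.hasFDerivAt
    exact norm_image_sub_le_of_punctured (H := fun z => f z - L z)
      (fun p hp hpq => (hdd p hp hpq).differentiableAt)
      (fun p hp hpq => by
        rw [(hdd p hp hpq).fderiv]
        exact hρL p (Metric.ball_subset_ball (min_le_right _ _) hp) hpq) hy hx hyq hxq
  have hid : Tendsto (fun y : Plane => y) (𝓝[≠] q) (𝓝 q) := nhdsWithin_le_nhds
  have h1 : Tendsto (fun y => ‖(f x - L x) - (f y - L y)‖) (𝓝[≠] q)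
      (𝓝 ‖(f x - L x) - (f q - L q)‖) :=
    (((hc.tendsto.mono_left nhdsWithin_le_nhds).sub
      (L.continuous.continuousAt.tendsto.mono_left nhdsWithin_le_nhds)).const_sub _).norm
  have h2 : Tendsto (fun y => ε * ‖x - y‖) (𝓝[≠] q) (𝓝 (ε * ‖x - q‖)) :=
    ((hid.const_sub x).norm).const_mul _
  have h3 := le_of_tendsto_of_tendsto h1 h2 (by
    filter_upwards [nhdsWithin_le_nhds (Metric.ball_mem_nhds q hm), self_mem_nhdsWithin] with y hy hyq
    exact key y hy hyq)
  have e : f x - f q - L (x - q) = (f x - L x) - (f q - L q) := by rw [map_sub]; abel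
  rw [e]
  exact h3

theorem contDiffOn_one_iff_of_isOpen {E F : Type*} [NormedAddCommGroup E] [NormedSpace ℝ E]
    [NormedAddCommGroup F] [NormedSpace ℝ F] {f : E → F} {s : Set E} (hs : IsOpen s) :
    ContDiffOn ℝ 1 f s ↔ DifferentiableOn ℝ f s ∧ ContinuousOn (fderiv ℝ f) s := by
  have := contDiffOn_succ_iff_fderiv_of_isOpen (𝕜 := ℝ) (n := 0) (f := f) hs
  rw [zero_add, contDiffOn_zero] at this
  simpa using this

theorem norm_fderiv_three_eq (f : Plane → F) (p : Plane) :
    ‖fderiv ℝ (fderiv ℝ (fderiv ℝ f)) p‖ = ‖iteratedFDeriv ℝ 3 f p‖ := by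
  rw [← norm_iteratedFDeriv_one, norm_iteratedFDeriv_fderiv, norm_iteratedFDeriv_fderiv]

theorem differentiableAt_fderiv_fderiv {f : Plane → F} {p : Plane} (h : ContDiffAt ℝ 3 f p) :
    DifferentiableAt ℝ (fderiv ℝ (fderiv ℝ f)) p :=
  ((h.fderiv_right (m := 2) (by norm_num)).fderiv_right (m := 1) (by norm_num)).differentiableAt
    (by norm_num)

theorem lipschitzOnWith_iteratedFDeriv_two {f : Plane → F} {s : Set Plane} {C : ℝ≥0}
    (h : LipschitzOnWith C (fderiv ℝ (fderiv ℝ f)) s) :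
    LipschitzOnWith C (iteratedFDeriv ℝ 2 f) s := by
  apply LipschitzOnWith.of_dist_le_mul
  intro x hx y hy
  have h1 := h.dist_le_mul x hx y hy
  rw [dist_eq_norm] at h1 ⊢
  refine le_trans ?_ h1
  refine ContinuousMultilinearMap.opNorm_le_bound (norm_nonneg _) ?_
  intro m
  rw [sub_apply, iteratedFDeriv_two_apply, iteratedFDeriv_two_apply,
    Fin.prod_univ_two, ← mul_assoc]
  exact ContinuousLinearMap.le_opNorm₂ (fderiv ℝ (fderiv ℝ f) x - fderiv ℝ (fderiv ℝ f) y) _ _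

/-- An isolated singularity of a `C^1` map is removable for `C^{2,1}` regularity, when the third
derivative is bounded. -/
theorem contDiffOn_two_of_bounded_third_deriv [FiniteDimensional ℝ F] {f : Plane → F} {q : Plane}
    {r K : ℝ} (hr : 0 < r) (h1 : ContDiffOn ℝ 1 f (Metric.ball q r))
    (h3 : ∀ p ∈ Metric.ball q r, p ≠ q → ContDiffAt ℝ 3 f p)
    (hK : ∀ p ∈ Metric.ball q r, p ≠ q → ‖iteratedFDeriv ℝ 3 f p‖ ≤ K) :
    ContDiffOn ℝ 2 f (Metric.ball q r) ∧
      ∃ C, LipschitzOnWith C (iteratedFDeriv ℝ 2 f) (Metric.ball q r) := by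
  have hqm : q ∈ Metric.ball q r := Metric.mem_ball_self hr
  have hdH : ∀ p ∈ Metric.ball q r, p ≠ q → DifferentiableAt ℝ (fderiv ℝ (fderiv ℝ f)) p :=
    fun p hp hpq => differentiableAt_fderiv_fderiv (h3 p hp hpq)
  have hlip : LipschitzOnWith K.toNNReal (fderiv ℝ (fderiv ℝ f)) (Metric.ball q r \ {q}) := by
    apply LipschitzOnWith.of_dist_le_mul
    rintro x ⟨hx, hxq⟩ y ⟨hy, hyq⟩
    rw [dist_eq_norm, dist_eq_norm]
    refine (norm_image_sub_le_of_punctured hdH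
      (fun p hp hpq => (norm_fderiv_three_eq f p).trans_le (hK p hp hpq)) hy hx hyq hxq).trans ?_
    gcongr
    exact Real.le_coe_toNNReal K
  -- The Hessian is Lipschitz off `q`, so it has a Lipschitz extension `G`. The value `G q` is the
  -- limit of the Hessian at `q`, hence the derivative of `fderiv ℝ f` there.
  obtain ⟨G, hG, hGe⟩ := hlip.extend_finite_dimension
  have hfc := contDiffOn_one_iff_of_isOpen Metric.isOpen_ball |>.1 h1
  have hd2 : ∀ p ∈ Metric.ball q r, p ≠ q → DifferentiableAt ℝ (fderiv ℝ f) p := fun p hp hpq =>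
    ((h3 p hp hpq).fderiv_right (m := 1) (by norm_num)).differentiableAt (by norm_num)
  have hq : HasFDerivAt (fderiv ℝ f) (G q) q := by
    refine hasFDerivAt_of_tendsto_fderiv_punctured hr hd2
      (hfc.2.continuousAt (Metric.isOpen_ball.mem_nhds hqm)) ?_
    refine (hG.continuous.continuousAt.tendsto.mono_left nhdsWithin_le_nhds).congr' ?_
    filter_upwards [nhdsWithin_le_nhds (Metric.ball_mem_nhds q hr), self_mem_nhdsWithin] with y hy hyq
    exact (hGe ⟨hy, hyq⟩).symm
  have hHG : EqOn (fderiv ℝ (fderiv ℝ f)) G (Metric.ball q r) := by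
    intro p hp
    rcases eq_or_ne p q with rfl | hpq
    · exact hq.fderiv
    · exact hGe ⟨hp, hpq⟩
  constructor
  · rw [show (2 : WithTop ℕ∞) = 1 + 1 by norm_num,
      contDiffOn_succ_iff_fderiv_of_isOpen Metric.isOpen_ball]
    refine ⟨hfc.1, by simp, ?_⟩
    rw [contDiffOn_one_iff_of_isOpen Metric.isOpen_ball]
    refine ⟨fun p hp => ?_, hG.continuous.continuousOn.congr hHG⟩
    rcases eq_or_ne p q with rfl | hpq
    · exact hq.differentiableAt.differentiableWithinAt
    · exact (hd2 p hp hpq).differentiableWithinAt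
  · refine ⟨_, lipschitzOnWith_iteratedFDeriv_two (C := lipschitzExtensionConstant (Plane →L[ℝ] Plane →L[ℝ] F) * K.toNNReal)
      fun x hx y hy => ?_⟩
    rw [hHG hx, hHG hy]
    exact hG x y

end Removable

/-! ### Functions on an interval whose derivative cannot vanish -/

/-- A positive maximum of `f²` would be interior, and there `2 f f' = 0` with both factors nonzero.
-/
theorem eqOn_zero_of_deriv_ne_zero {f : ℝ → ℝ} (hc : ContinuousOn f (Icc 0 1)) (h0 : f 0 = 0)
    (h1 : f 1 = 0) (hd : ∀ s ∈ Ioo (0 : ℝ) 1, f s ≠ 0 → ∃ d, HasDerivAt f d s ∧ d ≠ 0) :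
    ∀ s ∈ Icc (0 : ℝ) 1, f s = 0 := by
  intro s hs
  by_contra hne
  obtain ⟨m, hm, hmax⟩ := isCompact_Icc.exists_isMaxOn ⟨s, hs⟩ (hc.pow 2)
  have hms : f s ^ 2 ≤ f m ^ 2 := hmax hs
  have hfm : f m ≠ 0 := by
    intro h
    rw [h] at hms
    have : 0 < f s ^ 2 := by positivity
    linarith
  have hm0 : m ≠ 0 := by rintro rfl; exact hfm h0
  have hm1 : m ≠ 1 := by rintro rfl; exact hfm h1
  have hmo : m ∈ Ioo (0 : ℝ) 1 := ⟨lt_of_le_of_ne hm.1 hm0.symm, lt_of_le_of_ne hm.2 hm1⟩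
  obtain ⟨d, hd1, hd0⟩ := hd m hmo hfm
  have := (hmax.isLocalMax (Icc_mem_nhds hmo.1 hmo.2)).hasDerivAt_eq_zero (hd1.pow 2)
  simp [hfm, hd0] at this

/-- In the application `f` is `v_e` along a line and `R` says that the point is not critical for
`v`; differentiability is known only there. After normalizing `f'(0) > 0` and `f(0) ≥ 0`, the
property `R` persists to the right and `f` grows at rate at least `m`. -/
theorem le_abs_endpoint_of_deriv_bound {f f1 : ℝ → ℝ} {R : ℝ → Prop} {η m : ℝ} (hη : 0 < η)
    (hm : 0 < m) (hc : ContinuousOn f (Icc (-η) η)) (hR : ∀ s ∈ Icc (-η) η, f s ≠ 0 → R s)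
    (hd : ∀ s ∈ Icc (-η) η, R s → HasDerivAt f (f1 s) s)
    (hd1 : ∀ s ∈ Icc (-η) η, R s → ContinuousAt f1 s)
    (hm1 : ∀ s ∈ Icc (-η) η, R s → m ≤ |f1 s|) (h0 : R 0) :
    m * η ≤ |f η| ∨ m * η ≤ |f (-η)| := by
  have mneg : ∀ s ∈ Icc (-η) η, -s ∈ Icc (-η) η :=
    fun s hs => ⟨by linarith [hs.2], by linarith [hs.1]⟩
  have m0 : (0 : ℝ) ∈ Icc (-η) η := ⟨by linarith, hη.le⟩
  wlog hpos : 0 < f1 0 generalizing f f1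
  · have hne : f1 0 ≠ 0 := fun h => by
      have := hm1 0 m0 h0
      rw [h, abs_zero] at this; linarith
    have := this (f := fun s => -f s) (f1 := fun s => -f1 s) hc.neg
      (fun s hs h => hR s hs (by simpa using h)) (fun s hs h => (hd s hs h).neg)
      (fun s hs h => (hd1 s hs h).neg) (fun s hs h => by simpa using hm1 s hs h)
      (by have := lt_of_le_of_ne (not_lt.1 hpos) hne; linarith)
    simpa using this
  wlog hf0 : 0 ≤ f 0 generalizing f f1 R
  · have := this (f := fun s => -f (-s)) (f1 := fun s => f1 (-s)) (R := fun s => R (-s))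
      (by simpa using h0) (hc.comp continuousOn_neg mneg).neg
      (fun s hs h => hR _ (mneg s hs) (by simpa using h))
      (fun s hs h => ((hd _ (mneg s hs) h).comp s (hasDerivAt_neg s)).neg.congr_deriv (by simp))
      (fun s hs h => ContinuousAt.comp (f := fun s : ℝ => -s) (hd1 _ (mneg s hs) h) continuousAt_neg)
      (fun s hs h => hm1 _ (mneg s hs) h) (by simpa using hpos)
      (by simp only [neg_zero]; linarith)
    simp only [abs_neg, neg_neg] at this
    exact this.symm
  left
  have hsub : Icc 0 η ⊆ Icc (-η) η := Icc_subset_Icc (by linarith) le_rfl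
  -- Where `R` fails, `f = 0`. But `f` first rises above `f(0) ≥ 0`, so a return to zero forces an
  -- interior positive maximum, against `|f'| ≥ m`.
  have hall : ∀ s ∈ Icc 0 η, R s := by
    intro s hs
    by_contra hRs
    have hs0 : 0 < s := lt_of_le_of_ne hs.1 (by rintro rfl; exact hRs h0)
    have hfs : f s = 0 := by
      by_contra h; exact hRs (hR s (hsub hs) h)
    obtain ⟨x, hx, hx0⟩ : ∃ x ∈ Ioo 0 s, f 0 < f x := by
      have h1 := (hd 0 m0 h0).hasDerivWithinAt (s := Ioi 0)
      have h2 := (hasDerivWithinAt_iff_tendsto_slope' (by simp)).1 h1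
      have h3 := h2.eventually (lt_mem_nhds hpos)
      obtain ⟨x, hx1, hx2⟩ := (h3.and (Ioo_mem_nhdsGT hs0)).exists
      refine ⟨x, hx2, ?_⟩
      rw [slope_def_field, sub_zero] at hx1
      have := (div_pos_iff_of_pos_right hx2.1).1 hx1
      linarith
    have hsub2 : Icc 0 s ⊆ Icc (-η) η := (Icc_subset_Icc le_rfl hs.2).trans hsub
    obtain ⟨y, hy, hmax⟩ := isCompact_Icc.exists_isMaxOn ⟨x, Ioo_subset_Icc_self hx⟩ (hc.mono hsub2)
    have hyx : f x ≤ f y := hmax (Ioo_subset_Icc_self hx)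
    have hy0 : y ≠ 0 := by rintro rfl; linarith
    have hys : y ≠ s := by rintro rfl; linarith
    have hyo : y ∈ Ioo 0 s := ⟨lt_of_le_of_ne hy.1 hy0.symm, lt_of_le_of_ne hy.2 hys⟩
    have hRy := hR y (hsub2 hy) (by linarith : 0 < f y).ne'
    have := (hmax.isLocalMax (Icc_mem_nhds hyo.1 hyo.2)).hasDerivAt_eq_zero (hd y (hsub2 hy) hRy)
    have h4 := hm1 y (hsub2 hy) hRy
    rw [this, abs_zero] at h4
    linarith
  have hf1 : ∀ s ∈ Icc 0 η, m ≤ f1 s := by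
    intro s hs
    have h1 := hm1 s (hsub hs) (hall s hs)
    rcases le_abs.1 h1 with h | h
    · exact h
    exfalso
    have hs2 : uIcc 0 s ⊆ Icc 0 η := uIcc_subset_Icc ⟨le_rfl, hη.le⟩ hs
    obtain ⟨x, hx, hx0⟩ := intermediate_value_uIcc (f := f1) (a := 0) (b := s)
      (fun x hx => (hd1 x (hsub (hs2 hx)) (hall x (hs2 hx))).continuousWithinAt)
      (mem_uIcc.2 (Or.inr ⟨by linarith, hpos.le⟩) : (0 : ℝ) ∈ _)
    have := hm1 x (hsub (hs2 hx)) (hall x (hs2 hx))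
    rw [hx0, abs_zero] at this
    linarith
  have := (convex_Icc 0 η).mul_sub_le_image_sub_of_le_deriv (f := f) (C := m)
    (hc.mono hsub)
    (fun s hs => (hd s (hsub (interior_subset hs)) (hall s (interior_subset
      hs))).differentiableAt.differentiableWithinAt)
    (fun s hs => by
      rw [(hd s (hsub (interior_subset hs)) (hall s (interior_subset hs))).deriv]
      exact hf1 s (interior_subset hs))
    0 ⟨le_rfl, hη.le⟩ η ⟨hη.le, le_rfl⟩ hη.le
  exact le_trans (by linarith) (le_abs_self _)

/-! ### Directional derivatives and restriction to lines -/

section Line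

set_option maxSynthPendingDepth 3

/-- The derivative of `g` in the direction `e`. -/
def dirDeriv (e : Plane) (g : Plane → ℝ) (p : Plane) : ℝ := fderiv ℝ g p e

theorem ContDiffAt.dirDeriv {n : ℕ} {g : Plane → ℝ} {p : Plane} (h : ContDiffAt ℝ (n + 1 : ℕ) g p)
    (e : Plane) : ContDiffAt ℝ n (dirDeriv e g) p :=
  (h.fderiv_right (m := n) (by norm_cast)).clm_apply contDiffAt_const

theorem ContDiffOn.dirDeriv {n : ℕ} {g : Plane → ℝ} {s : Set Plane}
    (h : ContDiffOn ℝ (n + 1 : ℕ) g s) (hs : IsOpen s) (e : Plane) :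
    ContDiffOn ℝ n (dirDeriv e g) s := fun _ hp =>
  (ContDiffAt.dirDeriv (h.contDiffAt (hs.mem_nhds hp)) e).contDiffWithinAt

theorem hasDerivAt_line {g : Plane → ℝ} {p e : Plane} {s : ℝ}
    (h : DifferentiableAt ℝ g (p + s • e)) :
    HasDerivAt (fun t => g (p + t • e)) (dirDeriv e g (p + s • e)) s := by
  have h1 : HasDerivAt (fun t : ℝ => p + t • e) e s := by
    simpa using ((hasDerivAt_id s).smul_const e).const_add p
  exact h.hasFDerivAt.comp_hasDerivAt s h1

theorem dirDeriv_dirDeriv {v : Plane → ℝ} {p : Plane} (h : DifferentiableAt ℝ (fderiv ℝ v) p)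
    (e e' : Plane) : dirDeriv e (dirDeriv e' v) p = fderiv ℝ (fderiv ℝ v) p e e' := by
  have : HasFDerivAt (dirDeriv e' v) _ p :=
    (ContinuousLinearMap.apply ℝ ℝ e').hasFDerivAt.comp p h.hasFDerivAt
  rw [dirDeriv, this.fderiv]
  rfl

theorem dirDeriv_three {v : Plane → ℝ} {p : Plane} (h : ContDiffAt ℝ 3 v p) (e e' e'' : Plane) :
    dirDeriv e (dirDeriv e' (dirDeriv e'' v)) p
      = fderiv ℝ (fderiv ℝ (fderiv ℝ v)) p e e' e'' := by
  have h1 : dirDeriv e' (dirDeriv e'' v) =ᶠ[𝓝 p] fun x => fderiv ℝ (fderiv ℝ v) x e' e'' := by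
    filter_upwards [h.eventually (by simp)] with x hx
    exact dirDeriv_dirDeriv ((hx.fderiv_right (m := 2) (by norm_num)).differentiableAt
      (by norm_num)) _ _
  have h2 : HasFDerivAt (fun x => fderiv ℝ (fderiv ℝ v) x e' e'') _ p :=
    (ContinuousLinearMap.apply ℝ ℝ e'').hasFDerivAt.comp p
      ((ContinuousLinearMap.apply ℝ (Plane →L[ℝ] ℝ) e').hasFDerivAt.comp p
        (differentiableAt_fderiv_fderiv h).hasFDerivAt)
  rw [dirDeriv, h1.fderiv_eq, h2.fderiv]
  rfl

theorem dirDeriv_congr {U : Set Plane} (hU : IsOpen U) {g h : Plane → ℝ} (hgh : EqOn g h U)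
    (e : Plane) : EqOn (dirDeriv e g) (dirDeriv e h) U := fun x hx => by
  have : g =ᶠ[𝓝 x] h := by filter_upwards [hU.mem_nhds hx] with y hy using hgh hy
  rw [dirDeriv, dirDeriv, this.fderiv_eq]

theorem dirDeriv_four_sq {w w1 w2 w3 : Plane → ℝ} {U : Set Plane} (hU : IsOpen U)
    (hw : ContDiffOn ℝ 4 w U) {e : Plane} (h1 : w1 = dirDeriv e w) (h2 : w2 = dirDeriv e w1)
    (h3 : w3 = dirDeriv e w2) {p : Plane} (hp : p ∈ U) :
    dirDeriv e (dirDeriv e (dirDeriv e (dirDeriv e (fun x => w x ^ 2)))) p =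
      6 * w2 p ^ 2 + 8 * w1 p * w3 p + 2 * w p * dirDeriv e w3 p := by
  have c1 : ContDiffOn ℝ 3 w1 U := h1 ▸ ContDiffOn.dirDeriv (n := 3) hw hU e
  have c2 : ContDiffOn ℝ 2 w2 U := h2 ▸ ContDiffOn.dirDeriv (n := 2) c1 hU e
  have c3 : ContDiffOn ℝ 1 w3 U := h3 ▸ ContDiffOn.dirDeriv (n := 1) c2 hU e
  have D : ∀ {g : Plane → ℝ} {n : ℕ}, n ≠ 0 → ContDiffOn ℝ n g U → ∀ x ∈ U,
      HasFDerivAt g (fderiv ℝ g x) x := fun hn hg x hx =>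
    ((hg.contDiffAt (hU.mem_nhds hx)).differentiableAt (by exact_mod_cast hn)).hasFDerivAt
  have d0 := D (n := 4) (by norm_num) hw
  have d1 := D (n := 3) (by norm_num) c1
  have d2 := D (n := 2) (by norm_num) c2
  have d3 := D (n := 1) (by norm_num) c3
  have f0 : ∀ x, fderiv ℝ w x e = w1 x := fun x => by rw [h1, dirDeriv]
  have f1 : ∀ x, fderiv ℝ w1 x e = w2 x := fun x => by rw [h2, dirDeriv]
  have f2 : ∀ x, fderiv ℝ w2 x e = w3 x := fun x => by rw [h3, dirDeriv]
  have e1 : EqOn (dirDeriv e (fun x => w x ^ 2)) (fun x => 2 * (w x * w1 x)) U := by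
    intro x hx
    have h : HasFDerivAt (fun x => w x ^ 2) _ x := (d0 x hx).pow 2
    rw [dirDeriv, h.fderiv]
    simp [f0]; ring
  have e2 : EqOn (dirDeriv e (fun x => 2 * (w x * w1 x)))
      (fun x => 2 * (w1 x ^ 2 + w x * w2 x)) U := by
    intro x hx
    have h : HasFDerivAt (fun x => 2 * (w x * w1 x)) _ x := ((d0 x hx).mul (d1 x hx)).const_mul 2
    rw [dirDeriv, h.fderiv]
    simp [f0, f1]; ring
  have e3 : EqOn (dirDeriv e (fun x => 2 * (w1 x ^ 2 + w x * w2 x)))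
      (fun x => 2 * (3 * (w1 x * w2 x) + w x * w3 x)) U := by
    intro x hx
    have h : HasFDerivAt (fun x => 2 * (w1 x ^ 2 + w x * w2 x)) _ x :=
      (((d1 x hx).pow 2).add ((d0 x hx).mul (d2 x hx))).const_mul 2
    rw [dirDeriv, h.fderiv]
    simp [f0, f1, f2]; ring
  have h : HasFDerivAt (fun x => 2 * (3 * (w1 x * w2 x) + w x * w3 x)) _ p :=
    ((((d1 p hp).mul (d2 p hp)).const_mul 3).add ((d0 p hp).mul (d3 p hp))).const_mul 2
  have cc := fun {g h : Plane → ℝ} (hgh : EqOn g h U) => dirDeriv_congr hU hgh e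
  rw [(cc (cc (cc e1))) hp, (cc (cc e2)) hp, cc e3 hp, dirDeriv, h.fderiv]
  simp [f0, f1, f2, dirDeriv]; ring

end Line

/-! ### Isolation of the critical point -/

section LocalTheorem

set_option maxSynthPendingDepth 3

theorem plane_eq_sum (e : Plane) :
    e = e 0 • EuclideanSpace.single 0 (1 : ℝ) + e 1 • EuclideanSpace.single 1 (1 : ℝ) := by
  ext i; fin_cases i <;> simp

theorem abs_coord_le_norm (e : Plane) (i : Fin 2) : |e i| ≤ ‖e‖ := by
  exact PiLp.norm_apply_le e i

/-- The determinant of the Hessian matrix. -/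
def hessDet (v : Plane → ℝ) (p : Plane) : ℝ :=
  fderiv ℝ (fderiv ℝ v) p (EuclideanSpace.single 0 1) (EuclideanSpace.single 0 1) *
    fderiv ℝ (fderiv ℝ v) p (EuclideanSpace.single 1 1) (EuclideanSpace.single 1 1) -
  fderiv ℝ (fderiv ℝ v) p (EuclideanSpace.single 0 1) (EuclideanSpace.single 1 1) ^ 2

/-- By Cayley–Hamilton, `tr B · B(e,e) = |Be|² + det B · |e|²`, and `|tr B| ≤ 2L`. This makes the
nonvanishing of `v_ee` quantitative. -/
theorem det_mul_norm_sq_le {B : Plane →L[ℝ] Plane →L[ℝ] ℝ}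
    (hs : B (EuclideanSpace.single 0 1) (EuclideanSpace.single 1 1)
      = B (EuclideanSpace.single 1 1) (EuclideanSpace.single 0 1)) {c L : ℝ} (hL : ‖B‖ ≤ L)
    (hc : c ≤ B (EuclideanSpace.single 0 1) (EuclideanSpace.single 0 1) *
      B (EuclideanSpace.single 1 1) (EuclideanSpace.single 1 1) -
      B (EuclideanSpace.single 0 1) (EuclideanSpace.single 1 1) ^ 2) (e : Plane) :
    c * ‖e‖ ^ 2 ≤ 2 * L * |B e e| := by
  have hb : ∀ i : Fin 2, |B (EuclideanSpace.single i 1) (EuclideanSpace.single i 1)| ≤ L := by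
    intro i
    have := (B.le_opNorm₂ (EuclideanSpace.single i 1) (EuclideanSpace.single i 1))
    simp only [PiLp.norm_single, norm_one, mul_one] at this
    exact this.trans hL
  have b0 := hb 0
  have b1 := hb 1
  have hn : ‖e‖ ^ 2 = e 0 ^ 2 + e 1 ^ 2 := by
    rw [EuclideanSpace.norm_sq_eq, Fin.sum_univ_two]; simp
  have hB : B e e = e 0 ^ 2 * B (EuclideanSpace.single 0 1) (EuclideanSpace.single 0 1)
      + 2 * e 0 * e 1 * B (EuclideanSpace.single 0 1) (EuclideanSpace.single 1 1)
      + e 1 ^ 2 * B (EuclideanSpace.single 1 1) (EuclideanSpace.single 1 1) := by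
    conv_lhs => rw [plane_eq_sum e]
    simp only [map_add, map_smul, add_apply, smul_apply,
      smul_eq_mul]
    rw [← hs]; ring
  generalize B (EuclideanSpace.single 0 1) (EuclideanSpace.single 0 1) = x at *
  generalize B (EuclideanSpace.single 1 1) (EuclideanSpace.single 1 1) = z at *
  generalize B (EuclideanSpace.single 0 1) (EuclideanSpace.single 1 1) = y at *
  have h1 : (x + z) * B e e = (e 0 * x + e 1 * y) ^ 2 + (e 0 * y + e 1 * z) ^ 2
      + (x * z - y ^ 2) * ‖e‖ ^ 2 := by rw [hB, hn]; ring
  have h2 : (x + z) * B e e ≤ (2 * L) * |B e e| := by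
    refine (le_abs_self _).trans ?_
    rw [abs_mul]
    gcongr
    exact (abs_add_le _ _).trans (by linarith)
  have h3 : c * ‖e‖ ^ 2 ≤ (x * z - y ^ 2) * ‖e‖ ^ 2 := by gcongr
  nlinarith [sq_nonneg (e 0 * x + e 1 * y), sq_nonneg (e 0 * y + e 1 * z)]

theorem fderiv_fderiv_symm {v : Plane → ℝ} {p : Plane} {n : WithTop ℕ∞} (hn : 2 ≤ n)
    (h : ContDiffAt ℝ n v p) (a b : Plane) :
    fderiv ℝ (fderiv ℝ v) p a b = fderiv ℝ (fderiv ℝ v) p b a :=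
  (h.isSymmSndFDerivAt (by simpa using hn)).eq a b

theorem differentiableAt_fderiv_of_contDiffAt {v : Plane → ℝ} {p : Plane} {n : WithTop ℕ∞}
    (hn : 2 ≤ n) (h : ContDiffAt ℝ n v p) : DifferentiableAt ℝ (fderiv ℝ v) p :=
  ((h.of_le hn).fderiv_right (m := 1) (by norm_num)).differentiableAt (by norm_num)

/-- A `C^{1,1}` function on the disc of radius `R` about `q`, whose squared directional derivatives
are `C^4`, which is `C^5` away from its critical points, and whose Hessian determinant is given, away
from `q`, by a positive continuous function `κ`. -/
structure IsDarbouxSolution (v κ : Plane → ℝ) (q : Plane) (R : ℝ) (C : ℝ≥0) : Prop where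
  contDiffOn_one : ContDiffOn ℝ 1 v (Metric.ball q R)
  lipschitz : LipschitzOnWith C (fderiv ℝ v) (Metric.ball q R)
  sq : ∀ e, ContDiffOn ℝ 4 (fun p => fderiv ℝ v p e ^ 2) (Metric.ball q R)
  regular : ∀ p ∈ Metric.ball q R, fderiv ℝ v p ≠ 0 → ContDiffAt ℝ 5 v p
  cont : ∀ p ∈ Metric.ball q R, p ≠ q → ContinuousAt κ p
  pos : ∀ p ∈ Metric.ball q R, p ≠ q → 0 < κ p
  hess : ∀ p ∈ Metric.ball q R, p ≠ q → ContDiffAt ℝ 5 v p → hessDet v p = κ p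

namespace IsDarbouxSolution

variable {v κ : Plane → ℝ} {q : Plane} {R : ℝ} {C : ℝ≥0}

theorem norm_hess_le (h : IsDarbouxSolution v κ q R C) {p : Plane} (hp : p ∈ Metric.ball q R) :
    ‖fderiv ℝ (fderiv ℝ v) p‖ ≤ C :=
  norm_fderiv_le_of_lipschitzOn ℝ (Metric.isOpen_ball.mem_nhds hp) h.lipschitz

theorem le_abs_hess (h : IsDarbouxSolution v κ q R C) {p : Plane} (hp : p ∈ Metric.ball q R)
    (hpq : p ≠ q) (hr : ContDiffAt ℝ 5 v p) {c : ℝ} (hc : c ≤ κ p) (e : Plane) :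
    c * ‖e‖ ^ 2 ≤ 2 * C * |fderiv ℝ (fderiv ℝ v) p e e| :=
  det_mul_norm_sq_le (fderiv_fderiv_symm (by norm_num) hr _ _) (h.norm_hess_le hp)
    (by rw [← h.hess p hp hpq hr] at hc; exact hc) e

theorem hess_ne_zero (h : IsDarbouxSolution v κ q R C) {p : Plane} (hp : p ∈ Metric.ball q R)
    (hpq : p ≠ q) (hr : ContDiffAt ℝ 5 v p) {e : Plane} (he : e ≠ 0) :
    fderiv ℝ (fderiv ℝ v) p e e ≠ 0 := by
  intro h0
  have h1 := h.le_abs_hess hp hpq hr le_rfl e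
  rw [h0, abs_zero, mul_zero] at h1
  have := h.pos p hp hpq
  have : 0 < κ p * ‖e‖ ^ 2 := by positivity
  linarith

theorem hasDerivAt_fderiv_line {p e : Plane} {s : ℝ} (hr : ContDiffAt ℝ 5 v (p + s • e)) :
    HasDerivAt (fun t : ℝ => fderiv ℝ v (p + t • e) e) (fderiv ℝ (fderiv ℝ v) (p + s • e) e e) s := by
  have hd := differentiableAt_fderiv_of_contDiffAt (by norm_num) hr
  have := hasDerivAt_line (g := dirDeriv e v) (p := p) (e := e) (s := s)
    (ContDiffAt.differentiableAt (n := 4) (ContDiffAt.dirDeriv (n := 4) hr e) (by norm_num))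
  rw [dirDeriv_dirDeriv hd] at this
  exact this

theorem continuousAt_fderiv (h : IsDarbouxSolution v κ q R C) {p : Plane}
    (hp : p ∈ Metric.ball q R) : ContinuousAt (fderiv ℝ v) p :=
  h.lipschitz.continuousOn.continuousAt (Metric.isOpen_ball.mem_nhds hp)

theorem continuousAt_fderiv_line (h : IsDarbouxSolution v κ q R C) {p e : Plane} {s : ℝ}
    (hp : p + s • e ∈ Metric.ball q R) :
    ContinuousAt (fun t : ℝ => fderiv ℝ v (p + t • e) e) s := by
  have h1 : ContinuousAt (fun t : ℝ => p + t • e) s := by fun_prop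
  exact (ContinuousAt.comp (f := fun t : ℝ => p + t • e) (h.continuousAt_fderiv hp) h1).clm_apply
    continuousAt_const

theorem ne_zero_of_apply {p e : Plane} (h : fderiv ℝ v p e ≠ 0) : fderiv ℝ v p ≠ 0 := by
  intro h0; rw [h0] at h; exact h rfl

/-- The critical set contains the segment between any two of its points. -/
theorem fderiv_eq_zero_of_segment (h : IsDarbouxSolution v κ q R C) {p e : Plane} (he : e ≠ 0)
    (hD : ∀ s ∈ Icc (0 : ℝ) 1, p + s • e ∈ Metric.ball q R)
    (hq : ∀ s ∈ Ioo (0 : ℝ) 1, p + s • e ≠ q)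
    (h0 : fderiv ℝ v p = 0) (h1 : fderiv ℝ v (p + e) = 0) :
    ∀ s ∈ Icc (0 : ℝ) 1, fderiv ℝ v (p + s • e) = 0 := by
  -- Only `v_e` vanishes so far. If `dv ≠ 0` somewhere on the segment, then `v` is `C^5` there and
  -- `v_ee ≠ 0`, against `v_e = 0` along the segment.
  have hz := eqOn_zero_of_deriv_ne_zero (f := fun t : ℝ => fderiv ℝ v (p + t • e) e)
    (fun s hs => (h.continuousAt_fderiv_line (hD s hs)).continuousWithinAt)
    (by simp [h0]) (by simp [h1]) (fun s hs hne => by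
      have hr := h.regular _ (hD s (Ioo_subset_Icc_self hs)) (ne_zero_of_apply hne)
      exact ⟨_, hasDerivAt_fderiv_line hr, h.hess_ne_zero (hD s (Ioo_subset_Icc_self hs))
        (hq s hs) hr he⟩)
  intro s hs
  by_contra hne
  have hs0 : s ≠ 0 := by rintro rfl; simp [h0] at hne
  have hs1 : s ≠ 1 := by rintro rfl; simp [h1] at hne
  have hso : s ∈ Ioo (0 : ℝ) 1 := ⟨lt_of_le_of_ne hs.1 hs0.symm, lt_of_le_of_ne hs.2 hs1⟩
  have hr := h.regular _ (hD s hs) hne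
  have hd := hasDerivAt_fderiv_line hr
  have hev : (fun t : ℝ => fderiv ℝ v (p + t • e) e) =ᶠ[𝓝 s] fun _ => 0 := by
    filter_upwards [Icc_mem_nhds hso.1 hso.2] with t ht using hz t ht
  have := (hd.congr_of_eventuallyEq hev.symm).unique (hasDerivAt_const s 0)
  exact h.hess_ne_zero (hD s hs) (hq s hso) hr he this

/-- Otherwise `v` is locally constant, hence smooth with zero Hessian determinant, whereas the
equation makes this determinant equal to `κ > 0`. -/
theorem not_eventually_critical (h : IsDarbouxSolution v κ q R C) {p : Plane}
    (hp : p ∈ Metric.ball q R) (hpq : p ≠ q) : ¬ ∀ᶠ x in 𝓝 p, fderiv ℝ v x = 0 := by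
  intro hev
  obtain ⟨ρ, hρ, hb⟩ := Metric.eventually_nhds_iff_ball.1
    (hev.and (Metric.isOpen_ball.eventually_mem hp))
  have hconst : ∀ x ∈ Metric.ball p ρ, v x = v p := fun x hx =>
    Metric.isOpen_ball.is_const_of_fderiv_eq_zero (convex_ball p ρ).isPreconnected
      (fun y hy => ((h.contDiffOn_one.differentiableOn (by norm_num)) y
        (hb y hy).2).mono_of_mem_nhdsWithin (nhdsWithin_le_nhds
          (Metric.isOpen_ball.mem_nhds (hb y hy).2))) (fun y hy => (hb y hy).1) hx
      (Metric.mem_ball_self hρ)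
  have hvc : v =ᶠ[𝓝 p] fun _ => v p := by
    filter_upwards [Metric.ball_mem_nhds p hρ] with x hx using hconst x hx
  have h5 : ContDiffAt ℝ 5 v p := contDiffAt_const.congr_of_eventuallyEq hvc
  have h2 : fderiv ℝ v =ᶠ[𝓝 p] fun _ => 0 := hev
  have h3 := h.hess p hp hpq h5
  have h4 := h.pos p hp hpq
  rw [hessDet, h2.fderiv_eq] at h3
  simp at h3
  linarith

/-- A noncritical `x` close to `p` would make `v_e` grow by a fixed amount along the line through
`x` parallel to the segment. The Lipschitz bound on `dv`, which vanishes on the segment itself,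
keeps `v_e` small there. So every point near `p` is critical, which `not_eventually_critical`
excludes. -/
theorem false_of_critical_segment (h : IsDarbouxSolution v κ q R C) {p e : Plane} (he : e ≠ 0)
    (hD : p ∈ Metric.ball q R) (hpq : p ≠ q)
    (hcrit : ∀ s ∈ Icc (-1 : ℝ) 1, fderiv ℝ v (p + s • e) = 0) : False := by
  set c := κ p / 2 with hc
  have hκ := h.pos p hD hpq
  have hc0 : 0 < c := by positivity
  obtain ⟨ρ, hρ, hb⟩ := Metric.eventually_nhds_iff_ball.1
    (((h.cont p hD hpq).eventually (le_mem_nhds (half_lt_self hκ))).and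
      ((Metric.isOpen_ball.eventually_mem hD).and (isOpen_ne.eventually_mem hpq)))
  have hen : 0 < ‖e‖ := norm_pos_iff.2 he
  obtain ⟨η, hη, hη1, hηρ⟩ : ∃ η > 0, η ≤ 1 ∧ η * ‖e‖ ≤ ρ / 2 := by
    refine ⟨min 1 (ρ / (2 * ‖e‖)), lt_min one_pos (by positivity), min_le_left _ _, ?_⟩
    calc min 1 (ρ / (2 * ‖e‖)) * ‖e‖ ≤ ρ / (2 * ‖e‖) * ‖e‖ := by gcongr; exact min_le_right _ _
      _ = ρ / 2 := by field_simp
  have hmem : ∀ x ∈ Metric.ball p (ρ / 2), ∀ s ∈ Icc (-η) η, x + s • e ∈ Metric.ball p ρ := by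
    intro x hx s hs
    rw [Metric.mem_ball, dist_eq_norm] at hx ⊢
    have h1 : ‖s • e‖ ≤ ρ / 2 := by
      rw [norm_smul]
      exact (mul_le_mul_of_nonneg_right (abs_le.2 hs) hen.le).trans hηρ
    calc ‖x + s • e - p‖ = ‖(x - p) + s • e‖ := by congr 1; abel
      _ ≤ _ := norm_add_le _ _
      _ < ρ := by linarith
  -- A lower bound for `|v_ee|` from `le_abs_hess`, with `C + 1` in place of `C` to keep the
  -- denominator positive.
  set m := c * ‖e‖ ^ 2 / (2 * (C + 1)) with hm
  have hm0 : 0 < m := by positivity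
  apply h.not_eventually_critical hD hpq
  have hC1 : 0 < (C + 1 : ℝ) * ‖e‖ := by positivity
  have hball : 0 < min (ρ / 2) (m * η / ((C + 1) * ‖e‖)) := by positivity
  filter_upwards [Metric.ball_mem_nhds p hball] with x hx
  by_contra hne
  have hx1 : x ∈ Metric.ball p (ρ / 2) := Metric.ball_subset_ball (min_le_left _ _) hx
  have hx2 : ‖x - p‖ < m * η / ((C + 1) * ‖e‖) := by
    rw [← dist_eq_norm]; exact lt_of_lt_of_le hx (min_le_right _ _)
  have hs1 : ∀ s ∈ Icc (-η) η, |fderiv ℝ v (x + s • e) e| < m * η := by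
    intro s hs
    have h1 := h.lipschitz.dist_le_mul _ (hb _ (hmem x hx1 s hs)).2.1 _
      (hb _ (hmem p (Metric.mem_ball_self (by positivity)) s hs)).2.1
    rw [hcrit s ⟨by linarith [hs.1], by linarith [hs.2]⟩, dist_zero_right, dist_add_right,
      dist_eq_norm] at h1
    calc |fderiv ℝ v (x + s • e) e| ≤ ‖fderiv ℝ v (x + s • e)‖ * ‖e‖ :=
          (fderiv ℝ v (x + s • e)).le_opNorm e
      _ ≤ C * ‖x - p‖ * ‖e‖ := by gcongr
      _ ≤ ‖x - p‖ * ((C + 1) * ‖e‖) := by nlinarith [mul_nonneg (norm_nonneg (x - p)) hen.le]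
      _ < m * η := by rwa [lt_div_iff₀ hC1] at hx2
  have hreg : ∀ s ∈ Icc (-η) η, fderiv ℝ v (x + s • e) ≠ 0 → ContDiffAt ℝ 5 v (x + s • e) :=
    fun s hs hn => h.regular _ (hb _ (hmem x hx1 s hs)).2.1 hn
  rcases le_abs_endpoint_of_deriv_bound (f := fun s : ℝ => fderiv ℝ v (x + s • e) e)
    (f1 := fun s : ℝ => fderiv ℝ (fderiv ℝ v) (x + s • e) e e)
    (R := fun s => fderiv ℝ v (x + s • e) ≠ 0) hη hm0
    (fun s hs => (h.continuousAt_fderiv_line (hb _ (hmem x hx1 s hs)).2.1).continuousWithinAt)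
    (fun s hs hn => ne_zero_of_apply hn)
    (fun s hs hn => hasDerivAt_fderiv_line (hreg s hs hn))
    (fun s hs hn => by
      have h1 : ContinuousAt (fun t : ℝ => x + t • e) s := by fun_prop
      have h2 : ContinuousAt (fderiv ℝ (fderiv ℝ v)) (x + s • e) :=
        (differentiableAt_fderiv_fderiv ((hreg s hs hn).of_le (by norm_num))).continuousAt
      exact ((ContinuousAt.comp (f := fun t : ℝ => x + t • e) h2 h1).clm_apply
        continuousAt_const).clm_apply continuousAt_const)
    (fun s hs hn => by
      have hbb := hb _ (hmem x hx1 s hs)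
      have h1 := h.le_abs_hess hbb.2.1 hbb.2.2 (hreg s hs hn) hbb.1 e
      rw [hm, div_le_iff₀ (by positivity)]
      nlinarith [abs_nonneg (fderiv ℝ (fderiv ℝ v) (x + s • e) e e)])
    (by simpa using hne) with h1 | h1
  · exact absurd h1 (not_le.2 (hs1 η ⟨by linarith, le_rfl⟩))
  · exact absurd h1 (not_le.2 (hs1 (-η) ⟨le_rfl, by linarith⟩))

/-- The critical point `q` is isolated. -/
theorem fderiv_ne_zero (h : IsDarbouxSolution v κ q R C) (hq : fderiv ℝ v q = 0) {p : Plane}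
    (hp : p ∈ Metric.ball q R) (hpq : p ≠ q) : fderiv ℝ v p ≠ 0 := by
  intro h0
  set e := p - q with he
  have he0 : e ≠ 0 := sub_ne_zero.2 hpq
  have hD : ∀ s ∈ Icc (0 : ℝ) 1, q + s • e ∈ Metric.ball q R := by
    intro s hs
    rw [Metric.mem_ball, dist_eq_norm] at hp ⊢
    rw [add_sub_cancel_left, norm_smul, Real.norm_of_nonneg hs.1]
    exact (mul_le_of_le_one_left (norm_nonneg _) hs.2).trans_lt hp
  have hcr := h.fderiv_eq_zero_of_segment he0 hD
    (fun s hs hqs => by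
      have : s • e = 0 := by simpa using hqs
      rcases smul_eq_zero.1 this with h1 | h1
      · exact hs.1.ne' h1
      · exact he0 h1) hq (by rw [he, add_sub_cancel]; exact h0)
  -- The outer half of the segment from `q` to `p`, recentred at its midpoint so that the centre
  -- differs from `q`.
  refine h.false_of_critical_segment (p := q + (3 / 4 : ℝ) • e) (e := (1 / 4 : ℝ) • e)
    (smul_ne_zero (by norm_num) he0) (hD _ (by norm_num)) (by simpa using he0) ?_
  intro s hs
  have := hcr (3 / 4 + s / 4) ⟨by linarith [hs.1], by linarith [hs.2]⟩
  convert this using 2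
  module

end IsDarbouxSolution

end LocalTheorem

/-! ### Boundedness of the third derivative -/

section ThirdDerivative

set_option maxSynthPendingDepth 3

/-- The cubes at `a + b` and `a - b` recover the mixed values `T a a b` and `T a b b`. The factor 8
counts the coordinate terms. -/
theorem norm_trilinear_le {T : Plane →L[ℝ] Plane →L[ℝ] Plane →L[ℝ] ℝ}
    (h12 : ∀ a b c, T a b c = T b a c) (h23 : ∀ a b c, T a b c = T a c b) {K : ℝ} (hK : 0 ≤ K)
    (h0 : |T (EuclideanSpace.single 0 1) (EuclideanSpace.single 0 1) (EuclideanSpace.single 0 1)| ≤ K)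
    (h1 : |T (EuclideanSpace.single 1 1) (EuclideanSpace.single 1 1) (EuclideanSpace.single 1 1)| ≤ K)
    (hp : |T (EuclideanSpace.single 0 1 + EuclideanSpace.single 1 1)
      (EuclideanSpace.single 0 1 + EuclideanSpace.single 1 1)
      (EuclideanSpace.single 0 1 + EuclideanSpace.single 1 1)| ≤ K)
    (hm : |T (EuclideanSpace.single 0 1 - EuclideanSpace.single 1 1)
      (EuclideanSpace.single 0 1 - EuclideanSpace.single 1 1)
      (EuclideanSpace.single 0 1 - EuclideanSpace.single 1 1)| ≤ K) :
    ‖T‖ ≤ 8 * K := by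
  set a : Plane := EuclideanSpace.single 0 1 with ha
  set b : Plane := EuclideanSpace.single 1 1 with hb
  have e1 : T a b a = T a a b := h23 _ _ _
  have e2 : T b a a = T a a b := (h12 _ _ _).trans e1
  have e3 : T b a b = T a b b := h12 _ _ _
  have e4 : T b b a = T a b b := (h23 _ _ _).trans e3
  have hp' : T (a + b) (a + b) (a + b) = T a a a + 3 * T a a b + 3 * T a b b + T b b b := by
    simp only [map_add, add_apply]
    rw [e1, e2, e3, e4]; ring
  have hm' : T (a - b) (a - b) (a - b) = T a a a - 3 * T a a b + 3 * T a b b - T b b b := by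
    simp only [map_sub, sub_apply]
    rw [e1, e2, e3, e4]; ring
  rw [hp'] at hp
  rw [hm'] at hm
  have k1 : |T a a b| ≤ K := by
    rw [abs_le] at *
    constructor <;> linarith
  have k2 : |T a b b| ≤ K := by
    rw [abs_le] at *
    constructor <;> linarith
  refine T.opNorm_le_bound (by positivity) fun x => ?_
  refine (T x).opNorm_le_bound (by positivity) fun y => ?_
  refine (T x y).opNorm_le_bound (by positivity) fun z => ?_
  have hx : ∀ w : Plane, w = w 0 • a + w 1 • b := plane_eq_sum
  have hxyz : T x y z = x 0 * y 0 * z 0 * T a a a + x 0 * y 0 * z 1 * T a a b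
      + x 0 * y 1 * z 0 * T a a b + x 0 * y 1 * z 1 * T a b b + x 1 * y 0 * z 0 * T a a b
      + x 1 * y 0 * z 1 * T a b b + x 1 * y 1 * z 0 * T a b b + x 1 * y 1 * z 1 * T b b b := by
    conv_lhs => rw [hx x, hx y, hx z]
    simp only [map_add, map_smul, add_apply, smul_apply, smul_eq_mul]
    rw [e1, e2, e3, e4]; ring
  have hterm : ∀ (i j k : Fin 2) (t : ℝ), |t| ≤ K →
      |x i * y j * z k * t| ≤ ‖x‖ * ‖y‖ * ‖z‖ * K := by
    intro i j k t ht
    rw [abs_mul, abs_mul, abs_mul]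
    have := abs_coord_le_norm x i
    have := abs_coord_le_norm y j
    have := abs_coord_le_norm z k
    gcongr
  rw [hxyz, Real.norm_eq_abs]
  have t1 := abs_le.1 (hterm 0 0 0 _ h0)
  have t2 := abs_le.1 (hterm 0 0 1 _ k1)
  have t3 := abs_le.1 (hterm 0 1 0 _ k1)
  have t4 := abs_le.1 (hterm 0 1 1 _ k2)
  have t5 := abs_le.1 (hterm 1 0 0 _ k1)
  have t6 := abs_le.1 (hterm 1 0 1 _ k2)
  have t7 := abs_le.1 (hterm 1 1 0 _ k2)
  have t8 := abs_le.1 (hterm 1 1 1 _ h1)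
  rw [abs_le, show 8 * K * ‖x‖ * ‖y‖ * ‖z‖ = 8 * (‖x‖ * ‖y‖ * ‖z‖ * K) by ring]
  constructor <;> linarith

theorem fderiv_three_symm {v : Plane → ℝ} {p : Plane} (h : ContDiffAt ℝ 3 v p) (a b c : Plane) :
    fderiv ℝ (fderiv ℝ (fderiv ℝ v)) p a b c = fderiv ℝ (fderiv ℝ (fderiv ℝ v)) p b a c ∧
    fderiv ℝ (fderiv ℝ (fderiv ℝ v)) p a b c = fderiv ℝ (fderiv ℝ (fderiv ℝ v)) p a c b := by
  constructor
  · have h1 : ContDiffAt ℝ 2 (fderiv ℝ v) p := h.fderiv_right (by norm_num)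
    rw [(h1.isSymmSndFDerivAt (by simp)).eq a b]
  · rw [← dirDeriv_three h, ← dirDeriv_three h]
    have h1 : dirDeriv b (dirDeriv c v) =ᶠ[𝓝 p] dirDeriv c (dirDeriv b v) := by
      filter_upwards [h.eventually (by simp)] with x hx
      have hd := differentiableAt_fderiv_of_contDiffAt (by norm_num) hx
      rw [dirDeriv_dirDeriv hd, dirDeriv_dirDeriv hd, fderiv_fderiv_symm (by norm_num) hx]
    rw [dirDeriv, h1.fderiv_eq, dirDeriv]

namespace IsDarbouxSolution

variable {v κ : Plane → ℝ} {q : Plane} {R : ℝ} {C : ℝ≥0}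

/-- The one-variable estimate is applied to `w = v_e` on lines in direction `e`, with `δ` and `N`
chosen once for all lines. -/
theorem exists_abs_third_deriv_le (h : IsDarbouxSolution v κ q R C) (hR : 0 < R)
    (hq : fderiv ℝ v q = 0) {e : Plane} (he : e ≠ 0) :
    ∃ K, ∀ p ∈ Metric.ball q (R / 4), p ≠ q →
      |fderiv ℝ (fderiv ℝ (fderiv ℝ v)) p e e e| ≤ K := by
  have hreg : ∀ p ∈ Metric.ball q R, p ≠ q → ContDiffAt ℝ 5 v p := fun p hp hpq =>
    h.regular p hp (h.fderiv_ne_zero hq hp hpq)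
  have hen : 0 < ‖e‖ := norm_pos_iff.2 he
  set U : Set Plane := Metric.ball q R \ {q} with hU
  have hUo : IsOpen U := Metric.isOpen_ball.sdiff isClosed_singleton
  set w := dirDeriv e v with hw
  have cw : ContDiffOn ℝ 4 w U := fun p hp =>
    (ContDiffAt.dirDeriv (n := 4) (hreg p hp.1 hp.2) e).contDiffWithinAt
  obtain ⟨w1, hw1⟩ : ∃ w1, w1 = dirDeriv e w := ⟨_, rfl⟩
  obtain ⟨w2, hw2⟩ : ∃ w2, w2 = dirDeriv e w1 := ⟨_, rfl⟩
  obtain ⟨w3, hw3⟩ : ∃ w3, w3 = dirDeriv e w2 := ⟨_, rfl⟩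
  have c1 : ContDiffOn ℝ 3 w1 U := hw1 ▸ ContDiffOn.dirDeriv (n := 3) cw hUo e
  have c2 : ContDiffOn ℝ 2 w2 U := hw2 ▸ ContDiffOn.dirDeriv (n := 2) c1 hUo e
  have c3 : ContDiffOn ℝ 1 w3 U := hw3 ▸ ContDiffOn.dirDeriv (n := 1) c2 hUo e
  set G := dirDeriv e (dirDeriv e (dirDeriv e (dirDeriv e (fun x => w x ^ 2)))) with hG
  -- The fourth derivative of `w²` is continuous across `q`, although `w` itself is not known to be
  -- regular there. Its bound on a compact disc is what makes the estimate uniform up to `q`.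
  have cG : ContinuousOn G (Metric.ball q R) := by
    have hb := Metric.isOpen_ball (x := q) (ε := R)
    exact (ContDiffOn.dirDeriv (n := 0) (ContDiffOn.dirDeriv (n := 1) (ContDiffOn.dirDeriv (n := 2)
      (ContDiffOn.dirDeriv (n := 3) (h.sq e) hb e) hb e) hb e) hb e).continuousOn
  have hsub : Metric.closedBall q (R / 2) ⊆ Metric.ball q R :=
    Metric.closedBall_subset_ball (by linarith)
  obtain ⟨M, hM⟩ := (isCompact_closedBall q (R / 2)).exists_bound_of_continuousOn (cG.mono hsub)
  obtain ⟨M0, hM0⟩ := (isCompact_closedBall q (R / 2)).exists_bound_of_continuousOn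
    (f := fderiv ℝ v) (fun p hp => (h.continuousAt_fderiv (hsub hp)).continuousWithinAt)
  have hqc : q ∈ Metric.closedBall q (R / 2) := Metric.mem_closedBall_self (by positivity)
  have hMn : 0 ≤ M := (norm_nonneg _).trans (hM q hqc)
  have hM0n : 0 ≤ M0 := (norm_nonneg _).trans (hM0 q hqc)
  obtain ⟨δ, hδ, hδe⟩ : ∃ δ > 0, δ * ‖e‖ ≤ R / 4 := ⟨R / (4 * ‖e‖), by positivity, by
    apply le_of_eq; field_simp⟩
  obtain ⟨N, hN, hN1, hN2, hN3⟩ : ∃ N > 0, M ≤ N ^ 2 ∧ C * ‖e‖ * ‖e‖ ≤ N * δ ∧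
      M0 * ‖e‖ ≤ N * δ ^ 2 := by
    refine ⟨1 + M + C * ‖e‖ * ‖e‖ / δ + M0 * ‖e‖ / δ ^ 2, by positivity, ?_, ?_, ?_⟩
    · have h1 : 0 ≤ C * ‖e‖ * ‖e‖ / δ := by positivity
      have h2 : 0 ≤ M0 * ‖e‖ / δ ^ 2 := by positivity
      nlinarith
    · have h2 : 0 ≤ M0 * ‖e‖ / δ ^ 2 := by positivity
      rw [← div_le_iff₀ hδ]
      linarith
    · have h2 : 0 ≤ C * ‖e‖ * ‖e‖ / δ := by positivity
      rw [← div_le_iff₀ (by positivity)]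
      linarith
  have hmem : ∀ p ∈ Metric.ball q (R / 4), ∀ s ∈ Icc (-δ) δ,
      p + s • e ∈ Metric.closedBall q (R / 2) := by
    intro p hp s hs
    rw [Metric.mem_ball, dist_eq_norm] at hp
    rw [Metric.mem_closedBall, dist_eq_norm]
    have h1 : ‖s • e‖ ≤ R / 4 := by
      rw [norm_smul]
      exact (mul_le_mul_of_nonneg_right (abs_le.2 hs) hen.le).trans hδe
    calc ‖p + s • e - q‖ = ‖(p - q) + s • e‖ := by congr 1; abel
      _ ≤ _ := norm_add_le _ _
      _ ≤ R / 2 := by linarith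
  have hw1' : ∀ p ∈ U, w1 p = fderiv ℝ (fderiv ℝ v) p e e := fun p hp => by
    rw [hw1, hw, dirDeriv_dirDeriv (differentiableAt_fderiv_of_contDiffAt (by norm_num)
      (hreg p hp.1 hp.2))]
  have hw2' : ∀ p ∈ U, w2 p = fderiv ℝ (fderiv ℝ (fderiv ℝ v)) p e e e := fun p hp => by
    rw [hw2, hw1, hw, dirDeriv_three ((hreg p hp.1 hp.2).of_le (by norm_num))]
  have gen : ∀ p ∈ Metric.ball q (R / 4), (∀ s : ℝ, p + s • e ≠ q) → |w2 p| ≤ 500 * N := by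
    intro p hp hl
    have hmU : ∀ s ∈ Icc (-δ) δ, p + s • e ∈ U := fun s hs => ⟨hsub (hmem p hp s hs), hl s⟩
    have D : ∀ {g g' : Plane → ℝ} {n : ℕ}, n ≠ 0 → ContDiffOn ℝ n g U → g' = dirDeriv e g →
        ∀ s ∈ Icc (-δ) δ, HasDerivAt (fun t : ℝ => g (p + t • e)) (g' (p + s • e)) s := by
      rintro g g' n hn hg rfl s hs
      exact hasDerivAt_line ((hg.contDiffAt (hUo.mem_nhds (hmU s hs))).differentiableAt
        (by exact_mod_cast hn))
    have key := abs_second_deriv_le_of_sq (f := fun s : ℝ => w (p + s • e)) (δ := δ) (N := N) hδ hN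
      (D (n := 4) (by norm_num) cw hw1) (D (n := 3) (by norm_num) c1 hw2)
      (D (n := 2) (by norm_num) c2 hw3) (D (n := 1) (by norm_num) c3 rfl)
      (fun s hs => by
        rw [hw1' _ (hmU s hs)]
        exact h.hess_ne_zero (hmU s hs).1 (hl s) (hreg _ (hmU s hs).1 (hl s)) he)
      (fun s hs => by
        rw [hw1' _ (hmU s hs)]
        refine (ContinuousLinearMap.le_opNorm₂ (fderiv ℝ (fderiv ℝ v) (p + s • e)) e e).trans
          (le_trans ?_ hN2)
        gcongr
        exact h.norm_hess_le (hmU s hs).1)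
      (by
        have h0 := hmem p hp 0 ⟨by linarith, hδ.le⟩
        refine ((fderiv ℝ v (p + (0 : ℝ) • e)).le_opNorm e).trans (le_trans ?_ hN3)
        gcongr
        exact hM0 _ h0)
      (fun s hs => by
        rw [← dirDeriv_four_sq hUo cw hw1 hw2 hw3 (hmU s hs)]
        exact (hM _ (hmem p hp s hs)).trans hN1)
    simpa using key
  refine ⟨500 * N, fun p hp hpq => ?_⟩
  have hpU : p ∈ U := ⟨Metric.ball_subset_ball (by linarith) hp, hpq⟩
  rw [← hw2' p hpU]
  by_cases hl : ∀ s : ℝ, p + s • e ≠ q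
  · exact gen p hp hl
  push Not at hl
  obtain ⟨s, hs⟩ := hl
  -- The line through `p` hits `q`. Parallel lines miss it, and `w2` is continuous at `p`, so the
  -- bound passes to the limit.
  obtain ⟨y, hy⟩ := exists_linearIndependent_pair_of_one_lt_finrank (R := ℝ) (M := Plane) (by simp) he
  have hc : ContinuousAt (fun t : ℝ => p + t • y) 0 := by fun_prop
  have hc0 : Tendsto (fun t : ℝ => p + t • y) (𝓝[≠] 0) (𝓝 p) := by
    have := hc.tendsto
    simp only [zero_smul, add_zero] at this
    exact this.mono_left nhdsWithin_le_nhds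
  have h2 : ContinuousAt w2 p := c2.continuousOn.continuousAt (hUo.mem_nhds hpU)
  refine le_of_tendsto ((h2.tendsto.comp hc0).abs) ?_
  filter_upwards [hc0.eventually (Metric.isOpen_ball.mem_nhds hp), self_mem_nhdsWithin] with t ht ht0
  refine gen _ ht fun s' hs' => ht0 ?_
  have : (s' - s) • e + t • y = 0 := by
    have h3 : p + t • y + s' • e - (p + s • e) = 0 := by rw [hs', hs, sub_self]
    rw [← h3]; module
  exact (LinearIndependent.pair_iff.1 hy _ _ this).2

theorem exists_norm_third_deriv_le (h : IsDarbouxSolution v κ q R C) (hR : 0 < R)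
    (hq : fderiv ℝ v q = 0) :
    ∃ K, ∀ p ∈ Metric.ball q (R / 4), p ≠ q → ‖iteratedFDeriv ℝ 3 v p‖ ≤ K := by
  have hs0 : (EuclideanSpace.single 0 1 : Plane) ≠ 0 := by simp
  have hs1 : (EuclideanSpace.single 1 1 : Plane) ≠ 0 := by simp
  have hsp : (EuclideanSpace.single 0 1 + EuclideanSpace.single 1 1 : Plane) ≠ 0 := fun h => by
    have := congrArg (fun x : Plane => x 0) h; simp at this
  have hsm : (EuclideanSpace.single 0 1 - EuclideanSpace.single 1 1 : Plane) ≠ 0 := fun h => by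
    have := congrArg (fun x : Plane => x 0) h; simp at this
  obtain ⟨K0, h0⟩ := h.exists_abs_third_deriv_le hR hq hs0
  obtain ⟨K1, h1⟩ := h.exists_abs_third_deriv_le hR hq hs1
  obtain ⟨Kp, hp⟩ := h.exists_abs_third_deriv_le hR hq hsp
  obtain ⟨Km, hm⟩ := h.exists_abs_third_deriv_le hR hq hsm
  set K := max (max K0 K1) (max Kp Km) with hK
  refine ⟨8 * K, fun p hpb hpq => ?_⟩
  have hr : ContDiffAt ℝ 3 v p := by
    have hpR : p ∈ Metric.ball q R := Metric.ball_subset_ball (by linarith) hpb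
    exact (h.regular p hpR (h.fderiv_ne_zero hq hpR hpq)).of_le (by norm_num)
  rw [← norm_fderiv_three_eq]
  have l0 := (h0 p hpb hpq).trans ((le_max_left K0 K1).trans (le_max_left _ (max Kp Km)))
  exact norm_trilinear_le (fun a b c => (fderiv_three_symm hr a b c).1)
    (fun a b c => (fderiv_three_symm hr a b c).2) ((abs_nonneg _).trans l0) l0
    ((h1 p hpb hpq).trans ((le_max_right K0 K1).trans (le_max_left _ (max Kp Km))))
    ((hp p hpb hpq).trans ((le_max_left Kp Km).trans (le_max_right (max K0 K1) _)))
    ((hm p hpb hpq).trans ((le_max_right Kp Km).trans (le_max_right (max K0 K1) _)))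

end IsDarbouxSolution

end ThirdDerivative

/-! ### The Theorema Egregium in coordinates -/

section Gauss

set_option maxSynthPendingDepth 3

theorem partialDeriv_eq_dirDeriv (i : Fin 2) (f : Plane → ℝ) :
    partialDeriv i f = dirDeriv (EuclideanSpace.single i 1) f := rfl

theorem Filter.EventuallyEq.partialDeriv_eq {f g : Plane → ℝ} {p : Plane} (h : f =ᶠ[𝓝 p] g)
    (i : Fin 2) : partialDeriv i f p = partialDeriv i g p := by
  rw [partialDeriv, partialDeriv, h.fderiv_eq]

theorem partialDeriv_add {f g : Plane → ℝ} {p : Plane} (hf : DifferentiableAt ℝ f p)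
    (hg : DifferentiableAt ℝ g p) (i : Fin 2) :
    partialDeriv i (fun q => f q + g q) p = partialDeriv i f p + partialDeriv i g p := by
  rw [partialDeriv, fderiv_fun_add hf hg]; rfl

theorem partialDeriv_mul {f g : Plane → ℝ} {p : Plane} (hf : DifferentiableAt ℝ f p)
    (hg : DifferentiableAt ℝ g p) (i : Fin 2) :
    partialDeriv i (fun q => f q * g q) p = partialDeriv i f p * g p + f p * partialDeriv i g p := by
  rw [partialDeriv, fderiv_fun_mul hf hg]
  simp [partialDeriv]; ring

theorem partialDeriv_sum {ι : Type*} {s : Finset ι} {f : ι → Plane → ℝ} {p : Plane}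
    (hf : ∀ k ∈ s, DifferentiableAt ℝ (f k) p) (i : Fin 2) :
    partialDeriv i (fun q => ∑ k ∈ s, f k q) p = ∑ k ∈ s, partialDeriv i (f k) p := by
  rw [partialDeriv, fderiv_fun_sum hf]
  simp [partialDeriv]

theorem ContDiffAt.partialDeriv {n : ℕ} {f : Plane → ℝ} {p : Plane}
    (h : ContDiffAt ℝ (n + 1 : ℕ) f p) (i : Fin 2) : ContDiffAt ℝ n (partialDeriv i f) p :=
  ContDiffAt.dirDeriv h _

theorem ContDiffOn.partialDeriv {n : ℕ} {f : Plane → ℝ} {s : Set Plane}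
    (h : ContDiffOn ℝ (n + 1 : ℕ) f s) (hs : IsOpen s) (i : Fin 2) :
    ContDiffOn ℝ n (partialDeriv i f) s :=
  ContDiffOn.dirDeriv h hs _

theorem partialDeriv_comm {n : WithTop ℕ∞} (hn : 2 ≤ n) {f : Plane → ℝ} {p : Plane}
    (h : ContDiffAt ℝ n f p) (i j : Fin 2) :
    partialDeriv i (partialDeriv j f) p = partialDeriv j (partialDeriv i f) p := by
  have hd := differentiableAt_fderiv_of_contDiffAt hn h
  simp only [partialDeriv_eq_dirDeriv]
  rw [dirDeriv_dirDeriv hd, dirDeriv_dirDeriv hd, fderiv_fderiv_symm hn h]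

theorem contDiffOn_matrix_inv {n : WithTop ℕ∞} {g : Plane → Matrix (Fin 2) (Fin 2) ℝ}
    {U : Set Plane} (hg : ∀ i j, ContDiffOn ℝ n (fun p => g p i j) U)
    (hd : ∀ p ∈ U, (g p).det ≠ 0) (i j : Fin 2) : ContDiffOn ℝ n (fun p => (g p)⁻¹ i j) U := by
  have hdet : ContDiffOn ℝ n (fun p => (g p).det) U := by
    simp only [Matrix.det_fin_two]
    exact ((hg 0 0).mul (hg 1 1)).sub ((hg 0 1).mul (hg 1 0))
  have hinv := hdet.inv hd
  have hadj : ContDiffOn ℝ n (fun p => (g p).adjugate i j) U := by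
    simp only [Matrix.adjugate_fin_two]
    fin_cases i <;> fin_cases j
    · simpa using hg 1 1
    · simpa using (hg 0 1).neg
    · simpa using (hg 1 0).neg
    · simpa using hg 0 0
  refine (hinv.mul hadj).congr fun p _ => ?_
  rw [Matrix.inv_def, Ring.inverse_eq_inv', Matrix.smul_apply, smul_eq_mul]
  rfl

theorem contDiffOn_christoffel {g : Plane → Matrix (Fin 2) (Fin 2) ℝ} {U : Set Plane}
    (hU : IsOpen U) (hg : IsMetricOn 4 g U) (k i j : Fin 2) :
    ContDiffOn ℝ 3 (christoffel g k i j) U := by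
  have hd : ∀ i j k, ContDiffOn ℝ 3 (partialDeriv i (fun q => g q j k)) U := fun i j k =>
    ContDiffOn.partialDeriv (n := 3) (hg.contDiffOn j k) hU i
  have hi : ∀ i j, ContDiffOn ℝ 3 (fun p => (g p)⁻¹ i j) U := fun i j =>
    (contDiffOn_matrix_inv hg.contDiffOn (fun p hp => (hg.posDef p hp).det_pos.ne') i j).of_le
      (by norm_num)
  exact contDiffOn_const.mul (ContDiffOn.sum fun l _ =>
    (hi k l).mul (((hd i j l).add (hd j i l)).sub (hd l i j)))

theorem contDiffOn_gaussCurvature {g : Plane → Matrix (Fin 2) (Fin 2) ℝ} {U : Set Plane}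
    (hU : IsOpen U) (hg : IsMetricOn 4 g U) : ContDiffOn ℝ 2 (gaussCurvature g) U := by
  have hc := contDiffOn_christoffel hU hg
  have hd : ∀ i k l m, ContDiffOn ℝ 2 (partialDeriv i (christoffel g k l m)) U := fun i k l m =>
    ContDiffOn.partialDeriv (n := 2) (hc k l m) hU i
  have hc2 : ∀ k l m, ContDiffOn ℝ 2 (christoffel g k l m) U := fun k l m =>
    (hc k l m).of_le (by norm_num)
  have hg2 : ∀ i j, ContDiffOn ℝ 2 (fun p => g p i j) U := fun i j =>
    (hg.contDiffOn i j).of_le (by norm_num)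
  have hdet : ContDiffOn ℝ 2 (fun p => (g p).det) U := by
    simp only [Matrix.det_fin_two]
    exact ((hg2 0 0).mul (hg2 1 1)).sub ((hg2 0 1).mul (hg2 1 0))
  refine ContDiffOn.div (ContDiffOn.sum fun l _ => (hg2 0 l).mul ?_) hdet
    (fun p hp => (hg.posDef p hp).det_pos.ne')
  exact ((hd _ _ _ _).sub (hd _ _ _ _)).add (ContDiffOn.sum fun m _ =>
    ((hc2 _ _ _).mul (hc2 _ _ _)).sub ((hc2 _ _ _).mul (hc2 _ _ _)))

variable {g : Plane → Matrix (Fin 2) (Fin 2) ℝ} {X : Fin 3 → Plane → ℝ}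

/-- The inner product of a second and a first coordinate derivative of `X`. -/
def firstKind (X : Fin 3 → Plane → ℝ) (i j m : Fin 2) (q : Plane) : ℝ :=
  ∑ k, partialDeriv i (partialDeriv j (X k)) q * partialDeriv m (X k) q

theorem partialDeriv_metric {q : Plane} (hX : ∀ k, ContDiffAt ℝ 3 (X k) q)
    (hg : ∀ᶠ q in 𝓝 q, ∀ i j, g q i j = ∑ k, partialDeriv i (X k) q * partialDeriv j (X k) q)
    (m i j : Fin 2) :
    partialDeriv m (fun x => g x i j) q = firstKind X m i j q + firstKind X m j i q := by
  have hd : ∀ k i, DifferentiableAt ℝ (partialDeriv i (X k)) q := fun k i =>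
    (ContDiffAt.partialDeriv (n := 2) (hX k) i).differentiableAt (by norm_num)
  have h1 : (fun x => g x i j) =ᶠ[𝓝 q]
      fun x => ∑ k, partialDeriv i (X k) x * partialDeriv j (X k) x := by
    filter_upwards [hg] with x hx using hx i j
  rw [h1.partialDeriv_eq, partialDeriv_sum (fun k _ => (hd k i).fun_mul (hd k j)), firstKind, firstKind,
    ← Finset.sum_add_distrib]
  refine Finset.sum_congr rfl fun k _ => ?_
  rw [partialDeriv_mul (hd k i) (hd k j)]
  ring

/-- Once `∂_m g_ij` is expanded by the product rule, the Koszul combination leaves only `⟨∂_i∂_j X,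
∂_m X⟩`. -/
theorem sum_metric_mul_christoffel {q : Plane} (hX : ∀ k, ContDiffAt ℝ 3 (X k) q)
    (hg : ∀ᶠ q in 𝓝 q, ∀ i j, g q i j = ∑ k, partialDeriv i (X k) q * partialDeriv j (X k) q)
    (hdet : (g q).det ≠ 0) (i j m : Fin 2) :
    ∑ l, g q m l * christoffel g l i j q = firstKind X i j m q := by
  have hs : ∀ i j m, firstKind X i j m q = firstKind X j i m q := fun i j m =>
    Finset.sum_congr rfl fun k _ => by rw [partialDeriv_comm (by norm_num) (hX k)]
  have hc : ∀ l, christoffel g l i j q = ∑ n, (g q)⁻¹ l n * firstKind X i j n q := by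
    intro l
    rw [christoffel, Finset.mul_sum]
    refine Finset.sum_congr rfl fun n _ => ?_
    rw [partialDeriv_metric hX hg, partialDeriv_metric hX hg, partialDeriv_metric hX hg,
      hs j i n, hs n i j, hs n j i]
    ring
  have hm : ∀ n, ∑ l, g q m l * (g q)⁻¹ l n = if m = n then 1 else 0 := by
    intro n
    rw [← Matrix.mul_apply, Matrix.mul_nonsing_inv _ (isUnit_iff_ne_zero.2 hdet), Matrix.one_apply]
  have h0 := hm 0
  have h1 := hm 1
  simp only [hc, Fin.sum_univ_two] at h0 h1 ⊢
  have : firstKind X i j m q = (if m = 0 then 1 else 0) * firstKind X i j 0 q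
      + (if m = 1 then 1 else 0) * firstKind X i j 1 q := by
    fin_cases m <;> simp
  rw [this, ← h0, ← h1]
  ring

/-- The triple product of `∂₀X`, `∂₁X` and `∂ᵢ∂ⱼX`. -/
def tripleSecond (X : Fin 3 → Plane → ℝ) (i j : Fin 2) (p : Plane) : ℝ :=
  (partialDeriv 0 (X 1) p * partialDeriv 1 (X 2) p - partialDeriv 0 (X 2) p * partialDeriv 1 (X 1) p)
      * partialDeriv i (partialDeriv j (X 0)) p +
    (partialDeriv 0 (X 2) p * partialDeriv 1 (X 0) p
      - partialDeriv 0 (X 0) p * partialDeriv 1 (X 2) p) * partialDeriv i (partialDeriv j (X 1)) p +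
    (partialDeriv 0 (X 0) p * partialDeriv 1 (X 1) p
      - partialDeriv 0 (X 1) p * partialDeriv 1 (X 0) p) * partialDeriv i (partialDeriv j (X 2)) p

/-- The Theorema Egregium. -/
theorem gaussCurvature_mul_det_sq {p : Plane} (hX : ∀ k, ContDiffAt ℝ 3 (X k) p)
    (hg : ∀ᶠ q in 𝓝 p, ∀ i j, g q i j = ∑ k, partialDeriv i (X k) q * partialDeriv j (X k) q)
    (hdet : ∀ᶠ q in 𝓝 p, (g q).det ≠ 0)
    (hΓ : ∀ k i j, DifferentiableAt ℝ (christoffel g k i j) p)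
    (hgd : ∀ i j, DifferentiableAt ℝ (fun q => g q i j) p) :
    gaussCurvature g p * (g p).det ^ 2 =
      tripleSecond X 0 0 p * tripleSecond X 1 1 p - tripleSecond X 0 1 p ^ 2 := by
  have hd2 : ∀ k i, ContDiffAt ℝ 2 (partialDeriv i (X k)) p := fun k i =>
    ContDiffAt.partialDeriv (n := 2) (hX k) i
  have hd : ∀ k i, DifferentiableAt ℝ (partialDeriv i (X k)) p := fun k i =>
    (hd2 k i).differentiableAt (by norm_num)
  have hdd : ∀ k i j, DifferentiableAt ℝ (partialDeriv i (partialDeriv j (X k))) p := fun k i j =>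
    (ContDiffAt.partialDeriv (n := 1) (hd2 k j) i).differentiableAt (by norm_num)
  have hev : ∀ i j m, (fun q => ∑ l, g q m l * christoffel g l i j q) =ᶠ[𝓝 p]
      firstKind X i j m := by
    intro i j m
    have hX' : ∀ᶠ q in 𝓝 p, ∀ k, ContDiffAt ℝ 3 (X k) q :=
      eventually_all.2 fun k => (hX k).eventually (by simp)
    filter_upwards [hX', hg.eventually_nhds, hdet] with q h1 h2 h3
    exact sum_metric_mul_christoffel h1 h2 h3 i j m
  have hpt := fun i j m => (hev i j m).eq_of_nhds
  -- Derivative of the lowered Christoffel identity. Third derivatives of `X` appear here and cancel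
  -- in the antisymmetrization between `hD 0 1 1 0` and `hD 1 0 1 0`.
  have hD : ∀ n i j m, ∑ l, ((firstKind X n m l p + firstKind X n l m p) * christoffel g l i j p
      + g p m l * partialDeriv n (christoffel g l i j) p) =
      ∑ k, (partialDeriv n (partialDeriv i (partialDeriv j (X k))) p * partialDeriv m (X k) p +
        partialDeriv i (partialDeriv j (X k)) p * partialDeriv n (partialDeriv m (X k)) p) := by
    intro n i j m
    have h1 := (hev i j m).partialDeriv_eq n
    rw [partialDeriv_sum (fun l _ => (hgd m l).fun_mul (hΓ l i j))] at h1
    have h2 : partialDeriv n (firstKind X i j m) p = ∑ k,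
        (partialDeriv n (partialDeriv i (partialDeriv j (X k))) p * partialDeriv m (X k) p +
        partialDeriv i (partialDeriv j (X k)) p * partialDeriv n (partialDeriv m (X k)) p) := by
      rw [show firstKind X i j m = fun q => ∑ k, partialDeriv i (partialDeriv j (X k)) q *
        partialDeriv m (X k) q from rfl, partialDeriv_sum (fun k _ => (hdd k i j).fun_mul (hd k m))]
      exact Finset.sum_congr rfl fun k _ => partialDeriv_mul (hdd k i j) (hd k m) n
    rw [← h2, ← h1]
    refine Finset.sum_congr rfl fun l _ => ?_
    rw [partialDeriv_mul (hgd m l) (hΓ l i j), partialDeriv_metric hX hg]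
  have hs2 : ∀ k, partialDeriv 1 (partialDeriv 0 (X k)) p = partialDeriv 0 (partialDeriv 1 (X k)) p :=
    fun k => partialDeriv_comm (by norm_num) (hX k) 1 0
  have hs3 : ∀ k, partialDeriv 1 (partialDeriv 0 (partialDeriv 1 (X k))) p =
      partialDeriv 0 (partialDeriv 1 (partialDeriv 1 (X k))) p :=
    fun k => partialDeriv_comm (by norm_num) (hd2 k 1) 1 0
  have hsk : ∀ m, firstKind X 1 0 m p = firstKind X 0 1 m p := fun m => by
    simp only [firstKind, hs2]
  have a1 := hD 0 1 1 0
  have a2 := hD 1 0 1 0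
  simp only [hs2, hs3, Fin.sum_univ_two, hsk] at a1 a2
  rw [Finset.sum_add_distrib] at a1 a2
  have p000 := hpt 0 0 0
  have p010 := hpt 0 1 0
  have p011 := hpt 0 1 1
  have p110 := hpt 1 1 0
  have p111 := hpt 1 1 1
  have p100 := hpt 1 0 0
  simp only [Fin.sum_univ_two, hsk] at p000 p010 p011 p110 p111 p100
  have hE : ∑ l, g p 0 l * riemann g l 1 0 1 p =
      ∑ k, partialDeriv 1 (partialDeriv 1 (X k)) p * partialDeriv 0 (partialDeriv 0 (X k)) p
      - ∑ k, partialDeriv 0 (partialDeriv 1 (X k)) p * partialDeriv 0 (partialDeriv 1 (X k)) p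
      - (firstKind X 0 0 0 p * christoffel g 0 1 1 p + firstKind X 0 0 1 p * christoffel g 1 1 1 p)
      + (firstKind X 0 1 0 p * christoffel g 0 0 1 p
        + firstKind X 0 1 1 p * christoffel g 1 0 1 p) := by
    simp only [riemann, Fin.sum_univ_two]
    linear_combination a1 - a2 + christoffel g 0 1 1 p * p000 + christoffel g 1 1 1 p * p010
      - christoffel g 0 0 1 p * p100 - christoffel g 1 0 1 p * p110
  have hdp : (g p).det ≠ 0 := hdet.self_of_nhds
  have hgp := hg.self_of_nhds
  rw [gaussCurvature, show ∀ a d : ℝ, d ≠ 0 → a / d * d ^ 2 = d * a from fun a d h => by field_simp,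
    hE]
  swap
  · exact hdp
  have hsym : g p 1 0 = g p 0 1 := by
    rw [hgp, hgp]; exact Finset.sum_congr rfl fun k _ => mul_comm _ _
  have c0 : ∀ i j, (g p).det * christoffel g 0 i j p =
      g p 1 1 * firstKind X i j 0 p - g p 0 1 * firstKind X i j 1 p := by
    intro i j
    rw [← hpt i j 0, ← hpt i j 1, Matrix.det_fin_two]
    simp only [Fin.sum_univ_two]; ring
  have c1 : ∀ i j, (g p).det * christoffel g 1 i j p =
      g p 0 0 * firstKind X i j 1 p - g p 0 1 * firstKind X i j 0 p := by
    intro i j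
    rw [← hpt i j 0, ← hpt i j 1, Matrix.det_fin_two]
    simp only [Fin.sum_univ_two, hsym]; ring
  -- Multiplying by `det g` removes the inverse metric. What remains is a polynomial identity: the
  -- tangential terms are subtracted from `⟨X_00, X_11⟩ - |X_01|²`, and the normal parts left over
  -- are the triple products.
  have hfin : ∀ A : ℝ, (g p).det * (A
      - (firstKind X 0 0 0 p * christoffel g 0 1 1 p + firstKind X 0 0 1 p * christoffel g 1 1 1 p)
      + (firstKind X 0 1 0 p * christoffel g 0 0 1 p + firstKind X 0 1 1 p * christoffel g 1 0 1 p))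
      = (g p).det * A
      - (firstKind X 0 0 0 p * ((g p).det * christoffel g 0 1 1 p)
        + firstKind X 0 0 1 p * ((g p).det * christoffel g 1 1 1 p))
      + (firstKind X 0 1 0 p * ((g p).det * christoffel g 0 0 1 p)
        + firstKind X 0 1 1 p * ((g p).det * christoffel g 1 0 1 p)) := fun A => by ring
  rw [hfin, c0, c0, c1, c1, Matrix.det_fin_two, hsym]
  simp only [hgp, firstKind, tripleSecond, Fin.sum_univ_three]
  ring

end Gauss

/-! ### Regularity off critical points, and graph coordinates -/

section Coordinates

set_option maxSynthPendingDepth 3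

theorem fderiv_apply_coord {n : ℕ} {f : Plane → EuclideanSpace ℝ (Fin n)} {p : Plane}
    (h : DifferentiableAt ℝ f p) (e : Plane) (i : Fin n) :
    fderiv ℝ f p e i = fderiv ℝ (fun x => f x i) p e := by
  have : HasFDerivAt (fun x => f x i) _ p :=
    (EuclideanSpace.proj (𝕜 := ℝ) i).hasFDerivAt.comp p h.hasFDerivAt
  rw [this.fderiv]
  rfl

theorem fderiv_apply_eq_sum (f : Plane → ℝ) (p e : Plane) :
    fderiv ℝ f p e = e 0 * partialDeriv 0 f p + e 1 * partialDeriv 1 f p := by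
  conv_lhs => rw [plane_eq_sum e]
  simp [partialDeriv]

/-- A `C^1` function whose first derivatives have `C^4` products is `C^5` off its critical points. -/
theorem contDiffAt_five_of_products {u : Plane → ℝ} {U : Set Plane} (hU : IsOpen U)
    (hu : ContDiffOn ℝ 1 u U)
    (hprod : ∀ i j, ContDiffOn ℝ 4 (fun p => partialDeriv i u p * partialDeriv j u p) U)
    {p : Plane} (hp : p ∈ U) (hne : fderiv ℝ u p ≠ 0) : ContDiffAt ℝ 5 u p := by
  obtain ⟨i, hi⟩ : ∃ i, partialDeriv i u p ≠ 0 := by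
    by_contra! h
    apply hne
    ext e
    rw [fderiv_apply_eq_sum, h 0, h 1]
    simp
  have hmem := hU.mem_nhds hp
  have hc : ContinuousAt (partialDeriv i u) p :=
    (((contDiffOn_one_iff_of_isOpen hU).1 hu).2.continuousAt hmem).clm_apply continuousAt_const
  -- `∂_i u` equals plus or minus this root, with locally constant sign by continuity. The other
  -- derivative is a `C^4` product divided by `∂_i u`.
  have hsq : ContDiffAt ℝ 4 (fun x => √(partialDeriv i u x * partialDeriv i u x)) p :=
    ((hprod i i).contDiffAt hmem).sqrt (mul_self_ne_zero.2 hi)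
  have hci : ContDiffAt ℝ 4 (partialDeriv i u) p := by
    rcases hi.lt_or_gt with h | h
    · refine hsq.neg.congr_of_eventuallyEq ?_
      filter_upwards [hc.eventually (gt_mem_nhds h)] with x hx
      rw [Real.sqrt_mul_self_eq_abs, abs_of_neg hx, neg_neg]
    · refine hsq.congr_of_eventuallyEq ?_
      filter_upwards [hc.eventually (lt_mem_nhds h)] with x hx
      rw [Real.sqrt_mul_self_eq_abs, abs_of_pos hx]
  have hcj : ∀ j, ContDiffAt ℝ 4 (partialDeriv j u) p := by
    intro j
    refine (((hprod i j).contDiffAt hmem).div hci hi).congr_of_eventuallyEq ?_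
    filter_upwards [hc.eventually_ne hi] with x hx
    simp only [Pi.div_apply]
    field_simp
  rw [show (5 : WithTop ℕ∞) = (4 : ℕ) + 1 by norm_num, contDiffAt_succ_iff_hasFDerivAt]
  refine ⟨fderiv ℝ u, ⟨U, hmem, fun x hx => ?_⟩, ?_⟩
  · exact ((hu.contDiffAt (hU.mem_nhds hx)).differentiableAt (by norm_num)).hasFDerivAt
  · have : fderiv ℝ u = fun x => partialDeriv 0 u x • EuclideanSpace.proj (𝕜 := ℝ) (0 : Fin 2)
        + partialDeriv 1 u x • EuclideanSpace.proj (𝕜 := ℝ) (1 : Fin 2) := by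
      funext x
      ext e
      rw [fderiv_apply_eq_sum]
      simp; ring
    rw [this]
    exact ((hcj 0).smul contDiffAt_const).add ((hcj 1).smul contDiffAt_const)

/-- The map of the plane with components `α` and `β`. -/
def planeMap (α β : Plane → ℝ) (p : Plane) : Plane := !₂[α p, β p]

/-- The Jacobian determinant of `planeMap α β`. -/
def planeJac (α β : Plane → ℝ) (p : Plane) : ℝ :=
  partialDeriv 0 α p * partialDeriv 1 β p - partialDeriv 0 β p * partialDeriv 1 α p

variable {α β u v : Plane → ℝ} {p : Plane}

theorem contDiffAt_planeMap {n : WithTop ℕ∞} (hα : ContDiffAt ℝ n α p) (hβ : ContDiffAt ℝ n β p) :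
    ContDiffAt ℝ n (planeMap α β) p := by
  rw [contDiffAt_euclidean]
  intro i
  fin_cases i
  · simpa [planeMap] using hα
  · simpa [planeMap] using hβ

theorem fderiv_planeMap (hα : DifferentiableAt ℝ α p) (hβ : DifferentiableAt ℝ β p) (e : Plane) :
    fderiv ℝ (planeMap α β) p e = !₂[fderiv ℝ α p e, fderiv ℝ β p e] := by
  have hd : DifferentiableAt ℝ (planeMap α β) p := by
    rw [differentiableAt_euclidean]
    intro i
    fin_cases i
    · simpa [planeMap] using hα
    · simpa [planeMap] using hβ
  ext i
  rw [fderiv_apply_coord hd]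
  fin_cases i <;> simp [planeMap]

theorem partialDeriv_comp_planeMap {w : Plane → ℝ} (hw : DifferentiableAt ℝ w (planeMap α β p))
    (hα : DifferentiableAt ℝ α p) (hβ : DifferentiableAt ℝ β p) (j : Fin 2) :
    partialDeriv j (fun x => w (planeMap α β x)) p =
      partialDeriv 0 w (planeMap α β p) * partialDeriv j α p
        + partialDeriv 1 w (planeMap α β p) * partialDeriv j β p := by
  have hd : DifferentiableAt ℝ (planeMap α β) p := by
    rw [differentiableAt_euclidean]
    intro i
    fin_cases i
    · simpa [planeMap] using hα
    · simpa [planeMap] using hβ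
  have h : HasFDerivAt (fun x => w (planeMap α β x)) _ p :=
    hw.hasFDerivAt.comp p hd.hasFDerivAt
  rw [partialDeriv, h.fderiv, ContinuousLinearMap.comp_apply, fderiv_planeMap hα hβ,
    fderiv_apply_eq_sum]
  simp [partialDeriv]; ring

theorem partialDeriv_partialDeriv_comp_planeMap (hv : ContDiffAt ℝ 2 v (planeMap α β p))
    (hα : ContDiffAt ℝ 2 α p) (hβ : ContDiffAt ℝ 2 β p)
    (hu : ∀ᶠ x in 𝓝 p, u x = v (planeMap α β x)) (i j : Fin 2) :
    partialDeriv i (partialDeriv j u) p =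
      (partialDeriv 0 (partialDeriv 0 v) (planeMap α β p) * partialDeriv i α p
        + partialDeriv 1 (partialDeriv 0 v) (planeMap α β p) * partialDeriv i β p)
          * partialDeriv j α p
      + partialDeriv 0 v (planeMap α β p) * partialDeriv i (partialDeriv j α) p
      + ((partialDeriv 0 (partialDeriv 1 v) (planeMap α β p) * partialDeriv i α p
        + partialDeriv 1 (partialDeriv 1 v) (planeMap α β p) * partialDeriv i β p)
          * partialDeriv j β p
      + partialDeriv 1 v (planeMap α β p) * partialDeriv i (partialDeriv j β) p) := by
  have hψ := contDiffAt_planeMap hα hβ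
  have h1 : partialDeriv j u =ᶠ[𝓝 p] fun x =>
      partialDeriv 0 v (planeMap α β x) * partialDeriv j α x
        + partialDeriv 1 v (planeMap α β x) * partialDeriv j β x := by
    filter_upwards [hu.eventually_nhds, hα.eventually (by simp), hβ.eventually (by simp),
      hψ.continuousAt.eventually (hv.eventually (by simp))] with x hx ha hb hv'
    rw [Filter.EventuallyEq.partialDeriv_eq hx, partialDeriv_comp_planeMap
      (hv'.differentiableAt (by norm_num)) (ha.differentiableAt (by norm_num))
      (hb.differentiableAt (by norm_num))]
  have dα := hα.differentiableAt (by norm_num)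
  have dβ := hβ.differentiableAt (by norm_num)
  have dv : ∀ k, DifferentiableAt ℝ (partialDeriv k v) (planeMap α β p) := fun k =>
    (ContDiffAt.partialDeriv (n := 1) hv k).differentiableAt (by norm_num)
  have dvc : ∀ k, DifferentiableAt ℝ (fun x => partialDeriv k v (planeMap α β x)) p := fun k =>
    (dv k).comp p (hψ.differentiableAt (by norm_num))
  have dαj := (ContDiffAt.partialDeriv (n := 1) hα j).differentiableAt (by norm_num)
  have dβj := (ContDiffAt.partialDeriv (n := 1) hβ j).differentiableAt (by norm_num)
  rw [h1.partialDeriv_eq, partialDeriv_add ((dvc 0).fun_mul dαj) ((dvc 1).fun_mul dβj),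
    partialDeriv_mul (dvc 0) dαj, partialDeriv_mul (dvc 1) dβj,
    partialDeriv_comp_planeMap (dv 0) dα dβ, partialDeriv_comp_planeMap (dv 1) dα dβ]

theorem hessDet_eq {n : WithTop ℕ∞} (hn : 2 ≤ n) (hv : ContDiffAt ℝ n v p) :
    hessDet v p = partialDeriv 0 (partialDeriv 0 v) p * partialDeriv 1 (partialDeriv 1 v) p
      - partialDeriv 0 (partialDeriv 1 v) p ^ 2 := by
  have hd := differentiableAt_fderiv_of_contDiffAt hn hv
  simp only [partialDeriv_eq_dirDeriv, dirDeriv_dirDeriv hd]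
  rfl

/-- The second fundamental form of the graph of `v`, in the parameters given by `planeMap α β`. -/
theorem tripleSecond_det (hv : ContDiffAt ℝ 2 v (planeMap α β p))
    (hα : ContDiffAt ℝ 2 α p) (hβ : ContDiffAt ℝ 2 β p)
    (hu : ∀ᶠ x in 𝓝 p, u x = v (planeMap α β x)) :
    tripleSecond ![α, β, u] 0 0 p * tripleSecond ![α, β, u] 1 1 p
      - tripleSecond ![α, β, u] 0 1 p ^ 2 =
      planeJac α β p ^ 4 * hessDet v (planeMap α β p) := by
  have h1 : ∀ j, partialDeriv j u p = partialDeriv 0 v (planeMap α β p) * partialDeriv j α p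
        + partialDeriv 1 v (planeMap α β p) * partialDeriv j β p := fun j => by
    rw [Filter.EventuallyEq.partialDeriv_eq hu, partialDeriv_comp_planeMap
      (hv.differentiableAt (by norm_num)) (hα.differentiableAt (by norm_num))
      (hβ.differentiableAt (by norm_num))]
  have h2 := partialDeriv_partialDeriv_comp_planeMap hv hα hβ hu
  -- The triple product annihilates tangential vectors, so the second derivatives of `α` and `β`
  -- drop out. What is left is `J` times the Hessian of `v` pulled back by the Jacobian matrix,
  -- whose determinant contributes the other factor `J²`.
  have h3 : ∀ i j, tripleSecond ![α, β, u] i j p = planeJac α β p *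
      ((partialDeriv 0 (partialDeriv 0 v) (planeMap α β p) * partialDeriv i α p
        + partialDeriv 1 (partialDeriv 0 v) (planeMap α β p) * partialDeriv i β p)
          * partialDeriv j α p
      + (partialDeriv 0 (partialDeriv 1 v) (planeMap α β p) * partialDeriv i α p
        + partialDeriv 1 (partialDeriv 1 v) (planeMap α β p) * partialDeriv i β p)
          * partialDeriv j β p) := by
    intro i j
    simp only [tripleSecond, planeJac, Matrix.cons_val_zero, Matrix.cons_val_one, Matrix.cons_val]
    rw [h2, h1, h1]
    ring
  rw [h3, h3, h3, hessDet_eq le_rfl hv, partialDeriv_comm le_rfl hv 1 0, planeJac]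
  ring

end Coordinates

/-! ### Reduction to a graph near a critical point -/

section Critical

set_option maxSynthPendingDepth 3

variable {α β u : Plane → ℝ} {q : Plane}

theorem exists_local_inverse_planeMap {n : WithTop ℕ∞} (hn : 1 ≤ n) (hα : ContDiffAt ℝ n α q)
    (hβ : ContDiffAt ℝ n β q) (hJ : planeJac α β q ≠ 0) :
    ∃ φ : Plane → Plane, φ (planeMap α β q) = q ∧ ContDiffAt ℝ n φ (planeMap α β q) ∧
      (∀ᶠ y in 𝓝 (planeMap α β q), planeMap α β (φ y) = y) ∧
      ∀ᶠ x in 𝓝 q, φ (planeMap α β x) = x := by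
  have hn0 : n ≠ 0 := by rintro rfl; simp at hn
  have hψ := contDiffAt_planeMap hα hβ
  have hd := hψ.differentiableAt hn0
  have hinj : Function.Injective (fderiv ℝ (planeMap α β) q).toLinearMap := by
    rw [injective_iff_map_eq_zero]
    intro e he
    have he' : fderiv ℝ (planeMap α β) q e = 0 := he
    rw [fderiv_planeMap (hα.differentiableAt hn0) (hβ.differentiableAt hn0)] at he'
    have h0 : fderiv ℝ α q e = 0 := by simpa using congrArg (fun x : Plane => x 0) he'
    have h1 : fderiv ℝ β q e = 0 := by simpa using congrArg (fun x : Plane => x 1) he'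
    rw [fderiv_apply_eq_sum] at h0 h1
    have k0 : planeJac α β q * e 0 = 0 := by
      rw [planeJac]
      linear_combination partialDeriv 1 β q * h0 - partialDeriv 1 α q * h1
    have k1 : planeJac α β q * e 1 = 0 := by
      rw [planeJac]
      linear_combination partialDeriv 0 α q * h1 - partialDeriv 0 β q * h0
    ext i
    fin_cases i
    · simpa [hJ] using k0
    · simpa [hJ] using k1
  set A := (LinearEquiv.ofInjectiveEndo _ hinj).toContinuousLinearEquiv with hA
  have hfA : HasFDerivAt (planeMap α β) (A : Plane →L[ℝ] Plane) q :=
    hd.hasFDerivAt.congr_fderiv (by ext x i; rfl)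
  exact ⟨hψ.localInverse hfA hn0, hψ.localInverse_apply_image hfA hn0, hψ.to_localInverse hfA hn0,
    (hψ.hasStrictFDerivAt' hfA hn0).eventually_right_inverse,
    (hψ.hasStrictFDerivAt' hfA hn0).eventually_left_inverse⟩

/-- Both factors are locally bounded, so the product rule for differences applies. It makes the
chain-rule expression for `d(u ∘ φ)` Lipschitz. -/
theorem exists_lipschitzOnWith_clm_comp {A : Plane → Plane →L[ℝ] ℝ}
    {B : Plane → Plane →L[ℝ] Plane} {p : Plane} {CA CB : ℝ≥0} {s t : Set Plane} (hs : s ∈ 𝓝 p) (ht : t ∈ 𝓝 p)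
    (hA : LipschitzOnWith CA A s) (hB : LipschitzOnWith CB B t) :
    ∃ C : ℝ≥0, ∃ w ∈ 𝓝 p, LipschitzOnWith C (fun x => (A x).comp (B x)) w := by
  have hAc := (hA.continuousOn.continuousAt hs).norm.eventually (gt_mem_nhds (lt_add_one ‖A p‖))
  have hBc := (hB.continuousOn.continuousAt ht).norm.eventually (gt_mem_nhds (lt_add_one ‖B p‖))
  set a : ℝ≥0 := ‖A p‖₊ + 1
  set b : ℝ≥0 := ‖B p‖₊ + 1
  refine ⟨CA * b + a * CB, _, inter_mem (inter_mem hs ht) (inter_mem hAc hBc), ?_⟩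
  apply LipschitzOnWith.of_dist_le_mul
  rintro x ⟨⟨hxs, hxt⟩, hxA, hxB⟩ y ⟨⟨hys, hyt⟩, hyA, hyB⟩
  have h1 := hA.dist_le_mul x hxs y hys
  have h2 := hB.dist_le_mul x hxt y hyt
  rw [dist_eq_norm] at h1 h2 ⊢
  have e : (A x).comp (B x) - (A y).comp (B y) = (A x - A y).comp (B x) + (A y).comp (B x - B y) := by
    ext z
    simp
  rw [e]
  have hxB' : ‖B x‖ ≤ b := le_of_lt hxB
  have hyA' : ‖A y‖ ≤ a := le_of_lt hyA
  calc _ ≤ ‖(A x - A y).comp (B x)‖ + ‖(A y).comp (B x - B y)‖ := norm_add_le _ _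
    _ ≤ ‖A x - A y‖ * ‖B x‖ + ‖A y‖ * ‖B x - B y‖ :=
      add_le_add (ContinuousLinearMap.opNorm_comp_le _ _) (ContinuousLinearMap.opNorm_comp_le _ _)
    _ ≤ (CA * dist x y) * b + a * (CB * dist x y) := by gcongr
    _ = _ := by push_cast; ring

variable {U : Set Plane} {g : Plane → Matrix (Fin 2) (Fin 2) ℝ}

/-- The only regularity of `u` beyond `C^{1,1}` that the isometry gives directly. It loses no
derivative of `g` and one of `α, β`, whence `C^4` and `C^5`. -/
theorem contDiffOn_products (hU : IsOpen U) (hα : ContDiffOn ℝ 5 α U) (hβ : ContDiffOn ℝ 5 β U)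
    (hg : IsMetricOn 4 g U)
    (hiso : ∀ p ∈ U, ∀ i j, g p i j = partialDeriv i α p * partialDeriv j α p
      + partialDeriv i β p * partialDeriv j β p + partialDeriv i u p * partialDeriv j u p)
    (i j : Fin 2) : ContDiffOn ℝ 4 (fun p => partialDeriv i u p * partialDeriv j u p) U := by
  have da := fun i => ContDiffOn.partialDeriv (n := 4) hα hU i
  have db := fun i => ContDiffOn.partialDeriv (n := 4) hβ hU i
  refine ((hg.contDiffOn i j).sub (((da i).mul (da j)).add ((db i).mul (db j)))).congr fun p hp => ?_
  rw [hiso p hp i j]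
  ring

theorem exists_isDarbouxSolution (hU : IsOpen U) (hα : ContDiffOn ℝ 5 α U)
    (hβ : ContDiffOn ℝ 5 β U) (hu : ContDiffOn ℝ 1 u U) (hg : IsMetricOn 4 g U)
    (hiso : ∀ p ∈ U, ∀ i j, g p i j = partialDeriv i α p * partialDeriv j α p
      + partialDeriv i β p * partialDeriv j β p + partialDeriv i u p * partialDeriv j u p)
    (hk : ∀ p ∈ U, p ≠ 0 → 0 < gaussCurvature g p) (hq : q ∈ U)
    {L : ℝ≥0} {s : Set Plane} (hs : s ∈ 𝓝 q) (hL : LipschitzOnWith L (fderiv ℝ u) s)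
    {φ : Plane → Plane} (hφq : φ (planeMap α β q) = q)
    (hφ : ContDiffAt ℝ 5 φ (planeMap α β q))
    (hψφ : ∀ᶠ y in 𝓝 (planeMap α β q), planeMap α β (φ y) = y)
    (hφψ : ∀ᶠ x in 𝓝 q, φ (planeMap α β x) = x) (hJ : planeJac α β q ≠ 0) :
    ∃ κ, ∃ R > 0, ∃ C, IsDarbouxSolution (u ∘ φ) κ (planeMap α β q) R C := by
  have hφc : Tendsto φ (𝓝 (planeMap α β q)) (𝓝 q) := by
    have := hφ.continuousAt.tendsto
    rwa [hφq] at this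
  have hαat : ∀ p ∈ U, ContDiffAt ℝ 5 α p := fun p hp => hα.contDiffAt (hU.mem_nhds hp)
  have hβat : ∀ p ∈ U, ContDiffAt ℝ 5 β p := fun p hp => hβ.contDiffAt (hU.mem_nhds hp)
  have hJc : ∀ p ∈ U, ContinuousAt (planeJac α β) p := fun p hp => by
    have da := fun i => (ContDiffAt.partialDeriv (n := 4) (hαat p hp) i).continuousAt
    have db := fun i => (ContDiffAt.partialDeriv (n := 4) (hβat p hp) i).continuousAt
    exact ((da 0).mul (db 1)).sub ((db 0).mul (da 1))
  -- the Lipschitz constant of the differential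
  have hdu : ∀ p ∈ U, DifferentiableAt ℝ u p := fun p hp =>
    (hu.contDiffAt (hU.mem_nhds hp)).differentiableAt (by norm_num)
  have hchain : ∀ᶠ y in 𝓝 (planeMap α β q),
      fderiv ℝ (u ∘ φ) y = (fderiv ℝ u (φ y)).comp (fderiv ℝ φ y) := by
    filter_upwards [hφc.eventually (hU.mem_nhds hq), hφ.eventually (by simp)] with y hy hφy
    exact fderiv_comp y (hdu _ hy) (hφy.differentiableAt (by norm_num))
  obtain ⟨Kφ, tφ, htφ, hLφ⟩ := (hφ.of_le (by norm_num : (1 : WithTop ℕ∞) ≤ 5)).exists_lipschitzOnWith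
  obtain ⟨Kd, td, htd, hLd⟩ := (hφ.fderiv_right (m := 1) (by norm_num)).exists_lipschitzOnWith
  obtain ⟨C, w, hw, hLw⟩ := exists_lipschitzOnWith_clm_comp
    (A := fun y => fderiv ℝ u (φ y)) (s := tφ ∩ φ ⁻¹' s) (inter_mem htφ (hφc hs)) htd
    (hL.comp (hLφ.mono inter_subset_left) (fun y hy => hy.2)) hLd
  -- the parameter disc
  have hne0 : ∀ᶠ y in 𝓝 (planeMap α β q), y ≠ planeMap α β q → φ y ≠ 0 := by
    rcases eq_or_ne q 0 with h0 | h0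
    · filter_upwards [hψφ] with y hy hyq h
      apply hyq
      rw [← hy, h, h0]
    · filter_upwards [hφc.eventually_ne h0] with y hy _ using hy
  obtain ⟨R, hR, hb⟩ := Metric.eventually_nhds_iff_ball.1
    ((hφc.eventually (hU.mem_nhds hq)).and ((hφ.eventually (by simp)).and (hψφ.and
    ((hφc.eventually hφψ.eventually_nhds).and ((hφc.eventually ((hJc q hq).eventually_ne hJ)).and
    (hchain.and (hne0.and hw)))))))
  -- The value of `κ` comes from equating `k (det g)²` with `J⁴ det D²v`, by
  -- `gaussCurvature_mul_det_sq` and `tripleSecond_det`.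
  refine ⟨fun y => gaussCurvature g (φ y) * (g (φ y)).det ^ 2 / planeJac α β (φ y) ^ 4, R, hR, C,
    ?_, ?_, ?_, ?_, ?_, ?_, ?_⟩
  · intro y hy
    obtain ⟨hyU, hφy, -⟩ := hb y hy
    exact ((hu.contDiffAt (hU.mem_nhds hyU)).comp y (hφy.of_le (by norm_num))).contDiffWithinAt
  · intro x hx y hy
    rw [(hb x hx).2.2.2.2.2.1, (hb y hy).2.2.2.2.2.1]
    exact hLw (hb x hx).2.2.2.2.2.2.2 (hb y hy).2.2.2.2.2.2.2
  · intro e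
    have hprod := contDiffOn_products hU hα hβ hg hiso
    have hpc : ∀ i j, ∀ y ∈ Metric.ball (planeMap α β q) R,
        ContDiffAt ℝ 4 (fun y => partialDeriv i u (φ y) * partialDeriv j u (φ y)) y := by
      intro i j y hy
      have := (hprod i j).contDiffAt (hU.mem_nhds (hb y hy).1)
      exact this.comp y ((hb y hy).2.1.of_le (by norm_num))
    have hce : ∀ i, ∀ y ∈ Metric.ball (planeMap α β q) R,
        ContDiffAt ℝ 4 (fun y => fderiv ℝ φ y e i) y := by
      intro i y hy
      have h1 : ContDiffAt ℝ 4 (fun y => fderiv ℝ φ y e) y :=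
        ((hb y hy).2.1.fderiv_right (m := 4) (by norm_num)).clm_apply contDiffAt_const
      exact contDiffAt_euclidean.1 h1 i
    intro y hy
    -- `v_e²` is a quadratic form in the derivatives of `u`, evaluated on `dφ(e)`, so it involves
    -- only their `C^4` products.
    have hsum := ((((hce 0 y hy).pow 2).mul (hpc 0 0 y hy)).add
      ((contDiffAt_const (c := (2 : ℝ))).mul
        (((hce 0 y hy).mul (hce 1 y hy)).mul (hpc 0 1 y hy)))).add
      (((hce 1 y hy).pow 2).mul (hpc 1 1 y hy))
    refine (hsum.congr_of_eventuallyEq ?_).contDiffWithinAt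
    filter_upwards [Metric.isOpen_ball.mem_nhds hy] with z hz
    rw [(hb z hz).2.2.2.2.2.1, ContinuousLinearMap.comp_apply, fderiv_apply_eq_sum]
    ring
  · intro y hy hne
    obtain ⟨hyU, hφy, -, -, -, hch, -⟩ := hb y hy
    have hne' : fderiv ℝ u (φ y) ≠ 0 := by
      intro h0
      apply hne
      rw [hch, h0, ContinuousLinearMap.zero_comp]
    exact (contDiffAt_five_of_products hU hu (contDiffOn_products hU hα hβ hg hiso) hyU hne').comp y hφy
  · intro y hy hyq
    obtain ⟨hyU, hφy, -, -, hJy, -⟩ := hb y hy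
    have hmem := hU.mem_nhds hyU
    have hgc : ∀ i j, ContinuousAt (fun p => g p i j) (φ y) := fun i j =>
      (hg.contDiffOn i j).continuousOn.continuousAt hmem
    have hdet : ContinuousAt (fun p => (g p).det) (φ y) := by
      simp only [Matrix.det_fin_two]
      exact ((hgc 0 0).mul (hgc 1 1)).sub ((hgc 0 1).mul (hgc 1 0))
    have hkc := (contDiffOn_gaussCurvature hU hg).continuousOn.continuousAt hmem
    have hall : ContinuousAt (fun p => gaussCurvature g p * (g p).det ^ 2 / planeJac α β p ^ 4) (φ y) :=
      (hkc.mul (hdet.pow 2)).div ((hJc _ hyU).pow 4) (pow_ne_zero 4 hJy)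
    exact ContinuousAt.comp (f := φ) hall hφy.continuousAt
  · intro y hy hyq
    obtain ⟨hyU, hφy, -, -, hJy, -, hy0, -⟩ := hb y hy
    have := hk _ hyU (hy0 hyq)
    have hd := (hg.posDef _ hyU).det_pos
    have : 0 < planeJac α β (φ y) ^ 4 := by positivity
    positivity
  · intro y hy hyq h5
    obtain ⟨hyU, hφy, hψy, hφψy, hJy, -, -, -⟩ := hb y hy
    have hmem := hU.mem_nhds hyU
    have hev : ∀ᶠ x in 𝓝 (φ y), u x = (u ∘ φ) (planeMap α β x) := by
      filter_upwards [hφψy] with x hx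
      rw [Function.comp_apply, hx]
    have h5' : ContDiffAt ℝ 5 (u ∘ φ) (planeMap α β (φ y)) := by rwa [hψy]
    have hu5 : ContDiffAt ℝ 5 u (φ y) :=
      (h5'.comp (φ y) (contDiffAt_planeMap (hαat _ hyU) (hβat _ hyU))).congr_of_eventuallyEq hev
    have hX : ∀ k, ContDiffAt ℝ 3 (![α, β, u] k) (φ y) := by
      intro k
      fin_cases k
      · exact (hαat _ hyU).of_le (by norm_num)
      · exact (hβat _ hyU).of_le (by norm_num)
      · exact hu5.of_le (by norm_num)
    have hG := gaussCurvature_mul_det_sq (g := g) hX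
      (by
        filter_upwards [hmem] with x hx i j
        rw [hiso x hx, Fin.sum_univ_three]
        rfl)
      (by filter_upwards [hmem] with x hx using (hg.posDef x hx).det_pos.ne')
      (fun k i j => ((contDiffOn_christoffel hU hg k i j).contDiffAt hmem).differentiableAt
        (by norm_num))
      (fun i j => ((hg.contDiffOn i j).contDiffAt hmem).differentiableAt (by norm_num))
    rw [tripleSecond_det (h5'.of_le (by norm_num)) ((hαat _ hyU).of_le (by norm_num))
      ((hβat _ hyU).of_le (by norm_num)) hev, hψy] at hG
    have hJ4 : planeJac α β (φ y) ^ 4 ≠ 0 := pow_ne_zero 4 hJy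
    rw [eq_div_iff hJ4, hG, mul_comm]

/-- The bound for `v` in graph coordinates is carried back through `u = v ∘ ψ`, with `ψ` of class
`C^5`. -/
theorem exists_third_deriv_bound_of_critical (hU : IsOpen U) (hα : ContDiffOn ℝ 5 α U)
    (hβ : ContDiffOn ℝ 5 β U) (hu : ContDiffOn ℝ 1 u U) (hg : IsMetricOn 4 g U)
    (hiso : ∀ p ∈ U, ∀ i j, g p i j = partialDeriv i α p * partialDeriv j α p
      + partialDeriv i β p * partialDeriv j β p + partialDeriv i u p * partialDeriv j u p)
    (hk : ∀ p ∈ U, p ≠ 0 → 0 < gaussCurvature g p) (hq : q ∈ U)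
    {L : ℝ≥0} {s : Set Plane} (hs : s ∈ 𝓝 q) (hL : LipschitzOnWith L (fderiv ℝ u) s)
    (hcrit : fderiv ℝ u q = 0) :
    ∃ K, ∀ᶠ x in 𝓝 q, x ≠ q → ContDiffAt ℝ 5 u x ∧ ‖iteratedFDeriv ℝ 3 u x‖ ≤ K := by
  have hαat : ∀ p ∈ U, ContDiffAt ℝ 5 α p := fun p hp => hα.contDiffAt (hU.mem_nhds hp)
  have hβat : ∀ p ∈ U, ContDiffAt ℝ 5 β p := fun p hp => hβ.contDiffAt (hU.mem_nhds hp)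
  -- With `du = 0` at `q`, the metric there is the Gram matrix of `dα, dβ`, so `det g = J²`.
  have hJ : planeJac α β q ≠ 0 := by
    have hd := (hg.posDef q hq).det_pos
    have hu0 : ∀ i, partialDeriv i u q = 0 := fun i => by rw [partialDeriv, hcrit]; rfl
    rw [Matrix.det_fin_two] at hd
    simp only [hiso q hq, hu0] at hd
    intro h0
    have : planeJac α β q ^ 2 = 0 := by rw [h0]; norm_num
    rw [planeJac] at this
    nlinarith
  obtain ⟨φ, hφq, hφ, hψφ, hφψ⟩ :=
    exists_local_inverse_planeMap (by norm_num) (hαat q hq) (hβat q hq) hJ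
  obtain ⟨κ, R, hR, C, hD⟩ :=
    exists_isDarbouxSolution hU hα hβ hu hg hiso hk hq hs hL hφq hφ hψφ hφψ hJ
  set ψ := planeMap α β with hψ
  set v := u ∘ φ with hv
  have hvq : fderiv ℝ v (ψ q) = 0 := by
    have h1 : DifferentiableAt ℝ u (φ (ψ q)) := by
      rw [hφq]
      exact (hu.contDiffAt (hU.mem_nhds hq)).differentiableAt (by norm_num)
    rw [hv, fderiv_comp _ h1 (hφ.differentiableAt (by norm_num)), hφq, hcrit,
      ContinuousLinearMap.zero_comp]
  obtain ⟨K, hK⟩ := hD.exists_norm_third_deriv_le hR hvq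
  have hreg : ∀ y ∈ Metric.ball (ψ q) R, y ≠ ψ q → ContDiffAt ℝ 5 v y := fun y hy hyq =>
    hD.regular y hy (hD.fderiv_ne_zero hvq hy hyq)
  have hψat : ∀ p ∈ U, ContDiffAt ℝ 5 ψ p := fun p hp => contDiffAt_planeMap (hαat p hp) (hβat p hp)
  have hsub : Metric.closedBall (ψ q) (R / 4) ⊆ Metric.ball (ψ q) R :=
    Metric.closedBall_subset_ball (by linarith)
  obtain ⟨M0, hM0⟩ := (isCompact_closedBall (ψ q) (R / 4)).exists_bound_of_continuousOn
    (hD.contDiffOn_one.continuousOn.mono hsub)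
  obtain ⟨M1, hM1⟩ := (isCompact_closedBall (ψ q) (R / 4)).exists_bound_of_continuousOn
    (hD.lipschitz.continuousOn.mono hsub)
  have hbd : ∀ᶠ x in 𝓝 q, ∀ i ∈ Finset.range 4, ‖iteratedFDeriv ℝ i ψ x‖ <
      ‖iteratedFDeriv ℝ i ψ q‖ + 1 := by
    rw [Filter.eventually_all_finset]
    intro i hi
    have hi4 : i < 4 := Finset.mem_range.1 hi
    have hc : ContinuousAt (iteratedFDeriv ℝ i ψ) q :=
      (hψat q hq).continuousAt_iteratedFDeriv (by
        have : i ≤ 5 := by omega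
        exact_mod_cast this)
    exact hc.norm.eventually (gt_mem_nhds (lt_add_one _))
  -- The bound for iterated derivatives of a composition asks for `‖D^i ψ‖ ≤ D^i`. A sum dominating
  -- each term works because `D ≥ 1`.
  set D : ℝ := ∑ i ∈ Finset.range 4, (‖iteratedFDeriv ℝ i ψ q‖ + 1) with hDdef
  have hterm : ∀ i ∈ Finset.range 4, ‖iteratedFDeriv ℝ i ψ q‖ + 1 ≤ D := fun i hi =>
    Finset.single_le_sum (f := fun i => ‖iteratedFDeriv ℝ i ψ q‖ + 1) (fun j _ => by positivity) hi
  have hD1 : 1 ≤ D := le_trans (by linarith [norm_nonneg (iteratedFDeriv ℝ 0 ψ q)])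
    (hterm 0 (by simp))
  obtain ⟨ρ, hρ, hb⟩ := Metric.eventually_nhds_iff_ball.1
    ((hU.eventually_mem hq).and (hφψ.and (hbd.and
      ((hψat q hq).continuousAt.eventually (Metric.ball_mem_nhds (ψ q) (by positivity : 0 < R / 4))))))
  have hso : IsOpen (Metric.ball q ρ \ {q}) := Metric.isOpen_ball.sdiff isClosed_singleton
  have hto : IsOpen (Metric.ball (ψ q) (R / 4) \ {ψ q}) := Metric.isOpen_ball.sdiff isClosed_singleton
  have hmaps : MapsTo ψ (Metric.ball q ρ \ {q}) (Metric.ball (ψ q) (R / 4) \ {ψ q}) := by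
    rintro x ⟨hx, hxq⟩
    refine ⟨(hb x hx).2.2.2, fun h => hxq ?_⟩
    have h1 : ψ x = ψ q := h
    rw [mem_singleton_iff, ← (hb x hx).2.1, h1, hφq]
  have hballs : Metric.ball (ψ q) (R / 4) ⊆ Metric.ball (ψ q) R :=
    Metric.ball_subset_ball (by linarith)
  set M : ℝ := max (max M0 M1) (max C K) with hM
  refine ⟨(Nat.factorial 3 : ℝ) * M * D ^ 3,
    Metric.eventually_nhds_iff_ball.2 ⟨ρ, hρ, fun x hx hxq => ⟨?_, ?_⟩⟩⟩
  · have hxs : x ∈ Metric.ball q ρ \ {q} := ⟨hx, hxq⟩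
    have h1 := (hreg (ψ x) (hballs (hmaps hxs).1) (hmaps hxs).2).comp x (hψat x (hb x hx).1)
    refine h1.congr_of_eventuallyEq ?_
    filter_upwards [Metric.isOpen_ball.mem_nhds hx] with z hz
    rw [Function.comp_apply, hv, Function.comp_apply, (hb z hz).2.1]
  · have hxs : x ∈ Metric.ball q ρ \ {q} := ⟨hx, hxq⟩
    have hys := hmaps hxs
    have hcong : u =ᶠ[𝓝 x] v ∘ ψ := by
      filter_upwards [Metric.isOpen_ball.mem_nhds hx] with z hz
      rw [Function.comp_apply, hv, Function.comp_apply, (hb z hz).2.1]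
    rw [(hcong.iteratedFDeriv ℝ 3).eq_of_nhds, ← iteratedFDerivWithin_of_isOpen 3 hso hxs]
    refine norm_iteratedFDerivWithin_comp_le (N := 5) (t := Metric.ball (ψ q) (R / 4) \ {ψ q})
      (fun y hy => (hreg y (hballs hy.1) hy.2).contDiffWithinAt)
      (fun y hy => (hψat y (hb y hy.1).1).contDiffWithinAt) (by norm_num) hto.uniqueDiffOn
      hso.uniqueDiffOn hmaps hxs ?_ ?_
    · intro i hi
      rw [iteratedFDerivWithin_of_isOpen i hto hys]
      have hyc := Metric.ball_subset_closedBall hys.1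
      interval_cases i
      · rw [norm_iteratedFDeriv_zero]
        exact (hM0 _ hyc).trans ((le_max_left M0 M1).trans (le_max_left _ (max (C : ℝ) K)))
      · rw [norm_iteratedFDeriv_one]
        exact (hM1 _ hyc).trans ((le_max_right M0 M1).trans (le_max_left _ (max (C : ℝ) K)))
      · rw [← norm_iteratedFDeriv_fderiv, norm_iteratedFDeriv_one]
        exact (hD.norm_hess_le (hballs hys.1)).trans
          ((le_max_left (C : ℝ) K).trans (le_max_right (max M0 M1) _))
      · exact (hK _ hys.1 hys.2).trans ((le_max_right (C : ℝ) K).trans (le_max_right (max M0 M1) _))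
    · intro i hi1 hi3
      rw [iteratedFDerivWithin_of_isOpen i hso hxs]
      have hir : i ∈ Finset.range 4 := Finset.mem_range.2 (by omega)
      exact ((hb x hx).2.2.1 i hir).le.trans ((hterm i hir).trans (le_self_pow₀ hD1 (by omega)))

end Critical

/-! ### Assembling the local regularity -/

section Regularity

set_option maxSynthPendingDepth 3

theorem lipschitzOnWith_fderiv_coord {n : ℕ} {f : Plane → EuclideanSpace ℝ (Fin n)} {t : Set Plane}
    {K : ℝ≥0} (hd : ∀ x ∈ t, DifferentiableAt ℝ f x)
    (hK : LipschitzOnWith K (iteratedFDeriv ℝ 1 f) t) (i : Fin n) :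
    LipschitzOnWith K (fderiv ℝ fun x => f x i) t := by
  apply LipschitzOnWith.of_dist_le_mul
  intro x hx y hy
  refine le_trans ?_ (hK.dist_le_mul x hx y hy)
  rw [dist_eq_norm, dist_eq_norm]
  refine ContinuousLinearMap.opNorm_le_bound _ (norm_nonneg _) fun e => ?_
  have h1 := (PiLp.norm_apply_le
    ((iteratedFDeriv ℝ 1 f x - iteratedFDeriv ℝ 1 f y) fun _ => e) i).trans
    ((iteratedFDeriv ℝ 1 f x - iteratedFDeriv ℝ 1 f y).le_opNorm fun _ => e)
  rw [Fin.prod_univ_one, sub_apply, iteratedFDeriv_one_apply, iteratedFDeriv_one_apply,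
    PiLp.sub_apply, fderiv_apply_coord (hd x hx), fderiv_apply_coord (hd y hy)] at h1
  rwa [sub_apply]

/-- `C^{k,1}` regularity on an open set is local. -/
theorem isCk1On_of_local {F : Type*} [NormedAddCommGroup F] [NormedSpace ℝ F] {k : ℕ}
    {f : Plane → F} {U : Set Plane}
    (h : ∀ q ∈ U, ∃ s ∈ 𝓝 q, ContDiffAt ℝ k f q ∧
      ∃ C, LipschitzOnWith C (iteratedFDeriv ℝ k f) s) : IsCk1On k f U := by
  refine ⟨fun q hq => ?_, fun q hq => ?_⟩
  · obtain ⟨s, _, hf, _⟩ := h q hq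
    exact hf.contDiffWithinAt
  · obtain ⟨s, hs, _, C, hC⟩ := h q hq
    exact ⟨C, s, mem_nhdsWithin_of_mem_nhds hs, hC⟩

theorem contDiffAt_space {n : WithTop ℕ∞} {α β u : Plane → ℝ} {p : Plane} (hα : ContDiffAt ℝ n α p)
    (hβ : ContDiffAt ℝ n β p) (hu : ContDiffAt ℝ n u p) :
    ContDiffAt ℝ n (fun p => (!₂[α p, β p, u p] : Space)) p := by
  rw [contDiffAt_euclidean]
  intro i
  fin_cases i
  · exact hα
  · exact hβ
  · exact hu

/-- The map splits as a `C^5` part plus a fixed linear image of `u`, so only the bound on `u` can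
depend on the puncture. -/
theorem exists_norm_iteratedFDeriv_three_space_le {α β u : Plane → ℝ} {q : Plane} {K : ℝ}
    (hα : ContDiffAt ℝ 5 α q) (hβ : ContDiffAt ℝ 5 β q)
    (hu : ∀ᶠ x in 𝓝 q, x ≠ q → ContDiffAt ℝ 5 u x ∧ ‖iteratedFDeriv ℝ 3 u x‖ ≤ K) :
    ∃ K', ∀ᶠ x in 𝓝 q, x ≠ q → ContDiffAt ℝ 3 (fun p => (!₂[α p, β p, u p] : Space)) x ∧
      ‖iteratedFDeriv ℝ 3 (fun p => (!₂[α p, β p, u p] : Space)) x‖ ≤ K' := by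
  set Y : Plane → Space := fun p => !₂[α p, β p, 0] with hY
  set T : ℝ →L[ℝ] Space := ContinuousLinearMap.toSpanSingleton ℝ (EuclideanSpace.single 2 1) with hT
  have hX : (fun p => (!₂[α p, β p, u p] : Space)) = Y + T ∘ u := by
    ext p i
    fin_cases i <;> simp [hY, hT]
  have hYq : ContDiffAt ℝ 5 Y q := contDiffAt_space hα hβ contDiffAt_const
  have hYc : ContinuousAt (fun x => ‖iteratedFDeriv ℝ 3 Y x‖) q :=
    ((hYq.iteratedFDeriv_right (m := 0) (i := 3) (by norm_num)).continuousAt).norm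
  refine ⟨‖iteratedFDeriv ℝ 3 Y q‖ + 1 + ‖T‖ * K, ?_⟩
  filter_upwards [hu, hYq.eventually (by norm_num),
    hYc.eventually_lt_const (lt_add_one _)] with x hx hYx hYn hxq
  obtain ⟨hux, hK⟩ := hx hxq
  have hux3 : ContDiffAt ℝ 3 u x := hux.of_le (by norm_num)
  have hYx3 : ContDiffAt ℝ 3 Y x := hYx.of_le (by norm_num)
  have hTu : ContDiffAt ℝ 3 (T ∘ u) x := T.contDiff.contDiffAt.comp x hux3
  rw [hX]
  refine ⟨hYx3.add hTu, ?_⟩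
  rw [iteratedFDeriv_add_apply hYx3 hTu]
  refine (norm_add_le _ _).trans (add_le_add hYn.le ?_)
  exact (T.norm_iteratedFDeriv_comp_left hux3 (by norm_num)).trans (by gcongr)

/-- Graph coordinates of a `C^{1,1}` isometric immersion whose other two coordinates are `C^5`, of a
`C^4` metric that is positively curved off the origin, are `C^{2,1}`. -/
theorem isCk1On_two_of_isometric {U : Set Plane} {g : Plane → Matrix (Fin 2) (Fin 2) ℝ}
    {α β u : Plane → ℝ} (hU : IsOpen U) (hg : IsMetricOn 4 g U)
    (hk : ∀ p ∈ U, p ≠ 0 → 0 < gaussCurvature g p)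
    (hα : ContDiffOn ℝ 5 α U) (hβ : ContDiffOn ℝ 5 β U)
    (hX : IsCk1On 1 (fun p => (!₂[α p, β p, u p] : Space)) U)
    (hiso : ∀ p ∈ U, ∀ i j, inner ℝ (partialDeriv i (fun p => (!₂[α p, β p, u p] : Space)) p)
      (partialDeriv j (fun p => (!₂[α p, β p, u p] : Space)) p) = g p i j) :
    IsCk1On 2 (fun p => (!₂[α p, β p, u p] : Space)) U := by
  set X : Plane → Space := fun p => !₂[α p, β p, u p] with hXdef
  have hX1 : ContDiffOn ℝ 1 X U := hX.1
  have hdX : ∀ p ∈ U, DifferentiableAt ℝ X p := fun p hp =>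
    (hX1.contDiffAt (hU.mem_nhds hp)).differentiableAt (by norm_num)
  have hu : ContDiffOn ℝ 1 u U := contDiffOn_euclidean.1 hX1 2
  have hg' : ∀ p ∈ U, ∀ i j, g p i j = partialDeriv i α p * partialDeriv j α p
      + partialDeriv i β p * partialDeriv j β p + partialDeriv i u p * partialDeriv j u p := by
    intro p hp i j
    rw [← hiso p hp i j, PiLp.inner_apply, Fin.sum_univ_three]
    simp only [partialDeriv, fderiv_apply_coord (hdX p hp), RCLike.inner_apply, conj_trivial]
    simp only [hXdef, PiLp.toLp_apply, Matrix.cons_val_zero, Matrix.cons_val_one, Matrix.cons_val]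
    ring
  have hprod := contDiffOn_products hU hα hβ hg hg'
  apply isCk1On_of_local
  intro q hq
  -- At a critical point the third derivative is bounded off `q` and the singularity is removed;
  -- elsewhere the map is already `C^5`.
  by_cases hcrit : fderiv ℝ u q = 0
  · obtain ⟨K, t, ht, hK⟩ := hX.2 hq
    rw [hU.nhdsWithin_eq hq] at ht
    have hL : LipschitzOnWith K (fderiv ℝ u) (t ∩ U) :=
      lipschitzOnWith_fderiv_coord (f := X) (fun x hx => hdX x hx.2) (hK.mono inter_subset_left) 2
    obtain ⟨K1, hK1⟩ := exists_third_deriv_bound_of_critical hU hα hβ hu hg hg' hk hq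
      (inter_mem ht (hU.mem_nhds hq)) hL hcrit
    obtain ⟨K2, hK2⟩ := exists_norm_iteratedFDeriv_three_space_le
      (hα.contDiffAt (hU.mem_nhds hq)) (hβ.contDiffAt (hU.mem_nhds hq)) hK1
    obtain ⟨ρ, hρ, hb⟩ := Metric.eventually_nhds_iff_ball.1 (hK2.and (hU.mem_nhds hq))
    obtain ⟨h2, C, hC⟩ := contDiffOn_two_of_bounded_third_deriv hρ
      (hX1.mono fun x hx => (hb x hx).2) (fun p hp hpq => ((hb p hp).1 hpq).1)
      (fun p hp hpq => ((hb p hp).1 hpq).2)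
    exact ⟨_, Metric.ball_mem_nhds q hρ, h2.contDiffAt (Metric.ball_mem_nhds q hρ), C, hC⟩
  · have hX5 : ContDiffAt ℝ 5 X q := contDiffAt_space (hα.contDiffAt (hU.mem_nhds hq))
      (hβ.contDiffAt (hU.mem_nhds hq)) (contDiffAt_five_of_products hU hu hprod hq hcrit)
    obtain ⟨C, s, hs, hC⟩ := (hX5.iteratedFDeriv_right (m := 1) (i := 2)
      (by norm_num)).exists_lipschitzOnWith
    exact ⟨s, hs, hX5.of_le (by norm_num), C, hC⟩

end Regularity

end

theorem corollary3p2 (r : ℝ) (hr : 0 < r)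
    (g : Plane → Matrix (Fin 2) (Fin 2) ℝ)
    (hg : IsMetricOn 4 g (Metric.ball 0 r))
    (hk : ∀ p ∈ Metric.ball (0 : Plane) r, p ≠ 0 → 0 < gaussCurvature g p)
    (α β u : Plane → ℝ)
    (hX : IsC11IsometricEmbeddingOn g (fun p => !₂[α p, β p, u p]) (Metric.ball 0 r))
    (hα : ContDiffOn ℝ 5 α (Metric.ball 0 r))
    (hβ : ContDiffOn ℝ 5 β (Metric.ball 0 r))
    (hu : u 0 = 0)
    (hux : partialDeriv 0 u 0 = 0)
    (huy : partialDeriv 1 u 0 = 0) :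
    IsCk1On 2 (fun p => (!₂[α p, β p, u p] : Space)) (Metric.ball 0 r) :=
  isCk1On_two_of_isometric Metric.isOpen_ball hg hk hα hβ hX.isC11 hX.isometric
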